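/- Let $n\ge 1$ be an integer, let $k\ge\frac{n-1}{2n}$ be real, and put $\alpha=kn-\frac n2$. Let $$d\mu_{k,n}(x)=\frac{1}{2\Gamma(\alpha+1)}\Big(\frac n2\Big)^{\alpha}|x|^{2k+\frac2n-2}\,dx\quad\text{on }\mathbb R,\qquad L^p_{k,n}=L^p(\mathbb R,d\mu_{k,n}),$$ let $j_\nu(z)=\Gamma(\nu+1)\sum_{m\ge0}\frac{(-1)^m}{m!\,\Gamma(\nu+m+1)}\left(\frac z2\right)^{2m}$ be the normalized Bessel function, and let $$\mathcal F_{k,n}f(y)=\int_{\mathbb R}f(x)B_{k,n}(x,y)\,d\mu_{k,n}(x),$$ $$B_{k,n}(x,y)=j_\alpha\big(n|xy|^{\frac1n}\big)+(-i)^n\Big(\frac n2\Big)^n\frac{\Gamma(\alpha+1)}{\Gamma(\alpha+n+1)}\,xy\,j_{\alpha+n}\big(n|xy|^{\frac1n}\big).$$ Let $a,b,C>0$ and $p,q\in[1,\infty]$. For measurable $f:\mathbb R\to\mathbb C$ consider the two conditions $$e^{na|x|^{2/n}}f\in L^p_{k,n}+L^q_{k,n},\tag{i}$$ $$\int_{\mathbb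 R}\log^+\left|\frac{e^{nb|x|^{2/n}}\mathcal F_{k,n}f(x)}{C}\right|d\mu_{k,n}(x)<\infty,\tag{ii}$$ where $\log^+r=\max(\log r,0)$ for $r>0$ and $\log^+0=0$. Then: 1. If $ab>\frac14$, every measurable $f$ satisfying (i) and (ii) is $0$ almost everywhere. 2. If $ab=\frac14$, every measurable $f$ satisfying (i) and (ii) has the form $f(x)=\lambda e^{-na|x|^{2/n}}$ for almost every $x$, with a constant $\lambda\in\mathbb C$ such that $|\lambda|\le(2a)^{kn-\frac n2+1}C$. 3. If $ab<\frac14$, there are infinitely many functions satisfying (i) and (ii); indeed there is an infinite sequence of such functions that is linearly independent modulo equality almost everywhere. -/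

import Mathlib

open MeasureTheory
open scoped ENNReal

noncomputable section

namespace GenFourier

/-- The Bessel index `α = k n - n / 2`. -/
def index (n : ℕ) (k : ℝ) : ℝ := k * n - n / 2

/-- The normalized Bessel function
`j_α(z) = Γ(α+1) ∑_m (-1)^m / (m! Γ(α+m+1)) (z/2)^(2m)`, used here for `α > -1`
(the power series then converges for all complex `z`). -/
def besselj (α : ℝ) (z : ℂ) : ℂ :=
  (Real.Gamma (α + 1) : ℂ) *
    ∑' m : ℕ, (((-1) ^ m / ((Nat.factorial m : ℝ) * Real.Gamma (α + m + 1)) : ℝ) : ℂ)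
      * (z / 2) ^ (2 * m)

/-- The kernel of the one-dimensional `(k, 2/n)`-generalized Fourier transform,
`B(x, y) = j_α(n |y x|^(1/n))
  + (-i)^n (n/2)^n Γ(α+1) / Γ(α+n+1) y x j_{α+n}(n |y x|^(1/n))`. -/
def kernel (n : ℕ) (k x y : ℝ) : ℂ :=
  besselj (index n k) ((n * |y * x| ^ (1 / (n : ℝ)) : ℝ) : ℂ)
    + (-Complex.I) ^ n
      * (((n / 2 : ℝ) ^ n * (Real.Gamma (index n k + 1) / Real.Gamma (index n k + n + 1))
          * (y * x) : ℝ) : ℂ)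
      * besselj (index n k + n) ((n * |y * x| ^ (1 / (n : ℝ)) : ℝ) : ℂ)

/-- The weighted measure
`dμ(x) = (n/2)^α / (2 Γ(α+1)) |x|^(2k + 2/n - 2) dx` on the real line. -/
def mu (n : ℕ) (k : ℝ) : Measure ℝ :=
  volume.withDensity fun x =>
    ENNReal.ofReal (1 / (2 * Real.Gamma (index n k + 1)) * (n / 2 : ℝ) ^ index n k
      * |x| ^ (2 * k + 2 / (n : ℝ) - 2))

/-- The `(k, 2/n)`-generalized Fourier transform. -/
def transform (n : ℕ) (k : ℝ) (f : ℝ → ℂ) (y : ℝ) : ℂ :=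
  ∫ x, f x * kernel n k x y ∂(mu n k)

/-- `g ∈ L^p(μ) + L^q(μ)`. -/
def MemLpAddLp (g : ℝ → ℂ) (p q : ℝ≥0∞) (μ : Measure ℝ) : Prop :=
  ∃ g₁ g₂ : ℝ → ℂ, MemLp g₁ p μ ∧ MemLp g₂ q μ ∧ ∀ᵐ x ∂μ, g x = g₁ x + g₂ x

/-- `f` is (Lebesgue) measurable, `e^(n a |x|^(2/n)) f ∈ L^p + L^q`, and
`∫ log⁺ |e^(n b |x|^(2/n)) (F f)(x) / C| dμ(x) < ∞`. -/
def MiyachiCondition (n : ℕ) (k a b C : ℝ) (p q : ℝ≥0∞) (f : ℝ → ℂ) : Prop :=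
  AEStronglyMeasurable f volume ∧
  MemLpAddLp (fun x => (Real.exp (n * a * |x| ^ (2 / (n : ℝ))) : ℂ) * f x) p q (mu n k) ∧
  ∫⁻ x, ENNReal.ofReal (Real.posLog
    ‖(Real.exp (n * b * |x| ^ (2 / (n : ℝ))) : ℂ) * transform n k f x / (C : ℂ)‖) ∂(mu n k) < ⊤

end GenFourier

end

/-! Everything is reduced to entire functions of one complex variable. In the variable `s =
|y|^(1/n)` the transform is a Hankel-type transform of `f` of index `α` plus a constant times `y`
times one of `x f(x)` of index `α + n`. Both extend to even entire functions, so on each half line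
`y = ±s^n` the quantity `e^(nb s²) F f(y) / C` is the restriction of an entire function,
`halfTransform` with `σ = ±1`.

Condition (i) says that `f` is a Gaussian times the sum of a constant and an integrable function
(`GaussDom`). With `|j_ν(w)| ≤ e^|Im w|` (`norm_besselj_le`), completing the square bounds the
Hankel transforms by a polynomial times `e^(n (Im z)²/(4a))`. If `ab = 1/4`, this factor exactly
cancels the decay of `|e^(nb z²)|` in the imaginary direction. Hence `log⁺|h|`, for `h` either of
the two functions, is at most a logarithm plus `nb (Re z)²`, while (ii) makes it integrable on the
real line.

Miyachi's lemma (`GrowthBound.eq_const`) then makes `h` a constant of modulus at most 1. Its proof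
averages `log⁺|h|` over horizontal segments of length 2: the averages are bounded on the real axis
by integrability and on the imaginary axis by the growth bound, up to a logarithm. A
Phragmén–Lindelöf argument in each quadrant propagates this to the plane. The sub-mean value
property turns it into a pointwise bound, so `h` is a polynomial, and integrability leaves only
constants.

The two constants agree at `0`. So the odd part vanishes and the even part is a multiple of `e^(-nb
z²)`, the transform of the Gaussian; moments determine `f` (`ae_eq_zero_of_moments`), whence the
critical case. If `ab > 1/4`, lowering `b` to `1/(4a)` shows that `f` is a Gaussian multiple, and a
nonzero one violates (ii) with the original `b`. If `ab < 1/4`, Gaussians with parameter strictly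
between `a` and `1/(4b)` are examples. -/

namespace GenFourier

/-! ### Subharmonic functions and the maximum principle -/

/-- Continuous real functions on `ℂ` with the sub-mean value property on every circle. -/
structure IsSubmean (u : ℂ → ℝ) : Prop where
  continuous : Continuous u
  le_circleAverage : ∀ c r, 0 < r → u c ≤ Real.circleAverage u c r

theorem circleIntegrable_of_continuous {E : Type*} [NormedAddCommGroup E] {u : ℂ → E}
    (hu : Continuous u) (c : ℂ) (r : ℝ) : CircleIntegrable u c r :=
  (hu.comp (continuous_circleMap c r)).intervalIntegrable _ _

theorem circleAverage_re {g : ℂ → ℂ} (hg : Differentiable ℂ g) (c : ℂ) (r : ℝ) :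
    Real.circleAverage (fun z => (g z).re) c r = (g c).re := by
  have h := Complex.reCLM.circleAverage_comp_comm (c := c) (R := r)
    (circleIntegrable_of_continuous hg.continuous c r)
  rw [hg.diffContOnCl.circleAverage] at h
  exact h

theorem isSubmean_re {g : ℂ → ℂ} (hg : Differentiable ℂ g) : IsSubmean fun z => (g z).re :=
  ⟨Complex.continuous_re.comp hg.continuous, fun c r _ => (circleAverage_re hg c r).ge⟩

theorem IsSubmean.add {u v : ℂ → ℝ} (hu : IsSubmean u) (hv : IsSubmean v) :
    IsSubmean fun z => u z + v z := by
  refine ⟨hu.continuous.add hv.continuous, fun c r hr => ?_⟩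
  rw [Real.circleAverage_fun_add (circleIntegrable_of_continuous hu.continuous c r)
    (circleIntegrable_of_continuous hv.continuous c r)]
  exact add_le_add (hu.le_circleAverage c r hr) (hv.le_circleAverage c r hr)

/-- Jensen's formula: the circle average of `log|g|` exceeds `log|g(c)|` by a nonnegative
contribution of the zeros in the disc. Since averages of `log⁺` are nonnegative, the maximum with
`0` inherits the inequality. -/
theorem isSubmean_posLog_norm {g : ℂ → ℂ} (hg : Differentiable ℂ g) :
    IsSubmean fun z => Real.posLog ‖g z‖ := by
  have hcont : Continuous fun z => Real.posLog ‖g z‖ :=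
    Real.continuous_posLog.comp hg.continuous.norm
  refine ⟨hcont, fun c r hr => ?_⟩
  have hnn : 0 ≤ Real.circleAverage (fun z => Real.posLog ‖g z‖) c r :=
    Real.circleAverage_nonneg_of_nonneg fun _ _ => Real.posLog_nonneg
  by_cases h0 : g c = 0
  · simpa [h0] using hnn
  have han : AnalyticOnNhd ℂ g (Metric.closedBall c |r|) := fun x _ => hg.analyticAt x
  rw [Real.posLog_apply]
  refine max_le hnn ?_
  have hlog : Real.log ‖g c‖ ≤ Real.circleAverage (Real.log ‖g ·‖) c r := by
    rw [han.circleAverage_log_norm hr.ne' h0]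
    refine le_add_of_nonneg_left (finsum_nonneg fun u => ?_)
    by_cases hu : u ∈ Metric.closedBall c |r|
    · refine mul_nonneg (by exact_mod_cast MeromorphicOn.AnalyticOnNhd.divisor_nonneg han u) ?_
      rw [Metric.mem_closedBall, dist_comm, dist_eq_norm, abs_of_pos hr] at hu
      rcases eq_or_ne ‖c - u‖ 0 with h | h
      · simp [h]
      · refine Real.log_nonneg ?_
        rw [← div_eq_mul_inv, one_le_div (lt_of_le_of_ne (norm_nonneg _) h.symm)]
        exact hu
    · have : MeromorphicOn.divisor g (Metric.closedBall c |r|) u = 0 :=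
        Function.locallyFinsuppWithin.apply_eq_zero_of_notMem _ hu
      simp [this]
  refine hlog.trans (Real.circleAverage_mono ?_ (circleIntegrable_of_continuous hcont c r)
    fun x _ => le_max_right _ _)
  exact (han.mono Metric.sphere_subset_closedBall).meromorphicOn.circleIntegrable_log_norm

/-- The maximum principle on a rectangle. -/
theorem IsSubmean.le_of_rect {u : ℂ → ℝ} (hu : IsSubmean u) {R Θ M : ℝ}
    (hb : ∀ z : ℂ, 0 ≤ z.re → z.re ≤ R → 0 ≤ z.im → z.im ≤ Θ →
      (z.re = 0 ∨ z.re = R ∨ z.im = 0 ∨ z.im = Θ) → u z ≤ M)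
    {z : ℂ} (h1 : 0 ≤ z.re) (h2 : z.re ≤ R) (h3 : 0 ≤ z.im) (h4 : z.im ≤ Θ) : u z ≤ M := by
  by_contra! hM
  -- The strictly subharmonic perturbation `u + δ|z|²` costs at most half of the excess `u z - M` on
  -- the rectangle, so its maximum is still not on the boundary.
  set S : ℝ := R ^ 2 + Θ ^ 2 + 1 with hS
  have hSpos : 0 < S := by positivity
  set δ : ℝ := (u z - M) / (2 * S) with hδ
  have hδpos : 0 < δ := div_pos (by linarith) (by linarith)
  have hδS : δ * S = (u z - M) / 2 := by rw [hδ]; field_simp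
  set w : ℂ → ℝ := fun z => u z + δ * (z.re ^ 2 + z.im ^ 2) with hw
  have hwc : Continuous w := hu.continuous.add (by fun_prop)
  have hK : IsCompact (Set.Icc 0 R ×ℂ Set.Icc 0 Θ) := isCompact_Icc.reProdIm isCompact_Icc
  obtain ⟨z₁, hz₁, hmax⟩ := hK.exists_isMaxOn ⟨z, ⟨⟨h1, h2⟩, ⟨h3, h4⟩⟩⟩ hwc.continuousOn
  obtain ⟨⟨a1, a2⟩, ⟨a3, a4⟩⟩ := hz₁
  have hge : u z ≤ w z₁ := by
    have : w z ≤ w z₁ := hmax ⟨⟨h1, h2⟩, ⟨h3, h4⟩⟩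
    have h' : 0 ≤ δ * (z.re ^ 2 + z.im ^ 2) := by positivity
    simp only [hw] at this ⊢
    linarith
  have hnb : ¬ (z₁.re = 0 ∨ z₁.re = R ∨ z₁.im = 0 ∨ z₁.im = Θ) := by
    intro h
    have h5 := hb z₁ a1 a2 a3 a4 h
    have h6 : z₁.re ^ 2 + z₁.im ^ 2 ≤ S := by
      have := pow_le_pow_left₀ a1 a2 2
      have := pow_le_pow_left₀ a3 a4 2
      linarith
    have h7 := mul_le_mul_of_nonneg_left h6 hδpos.le
    simp only [hw] at hge
    linarith
  push Not at hnb
  obtain ⟨b1, b2, b3, b4⟩ := hnb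
  obtain ⟨r, hr0, hr1, hr2, hr3, hr4⟩ : ∃ r : ℝ, 0 < r ∧ r ≤ z₁.re ∧ r ≤ R - z₁.re ∧ r ≤ z₁.im ∧
      r ≤ Θ - z₁.im := by
    refine ⟨min (min z₁.re (R - z₁.re)) (min z₁.im (Θ - z₁.im)), ?_, ?_, ?_, ?_, ?_⟩
    · refine lt_min (lt_min ?_ ?_) (lt_min ?_ ?_)
      · exact lt_of_le_of_ne a1 (Ne.symm b1)
      · exact sub_pos.2 (lt_of_le_of_ne a2 b2)
      · exact lt_of_le_of_ne a3 (Ne.symm b3)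
      · exact sub_pos.2 (lt_of_le_of_ne a4 b4)
    · exact (min_le_left _ _).trans (min_le_left _ _)
    · exact (min_le_left _ _).trans (min_le_right _ _)
    · exact (min_le_right _ _).trans (min_le_left _ _)
    · exact (min_le_right _ _).trans (min_le_right _ _)
  -- On the circle of radius `r` about the maximum point `z₁`, expanding `|ζ|²` turns `w ζ ≤ w z₁`
  -- into `u ζ ≤ Re F ζ`. The average of `Re F` is `u z₁ - δ r²`, contradicting the sub-mean value
  -- property.
  let F : ℂ → ℂ := fun ζ => ((u z₁ - δ * r ^ 2 : ℝ) : ℂ)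
    - (2 * δ : ℝ) * ((starRingEnd ℂ) z₁ * (ζ - z₁))
  have hF : Differentiable ℂ F := by fun_prop
  have hle : Real.circleAverage u z₁ r ≤ Real.circleAverage (fun ζ => (F ζ).re) z₁ r := by
    refine Real.circleAverage_mono (circleIntegrable_of_continuous hu.continuous _ _)
      (circleIntegrable_of_continuous (Complex.continuous_re.comp hF.continuous) _ _) ?_
    intro ζ hζ
    rw [mem_sphere_iff_norm, abs_of_pos hr0] at hζ
    have hre := (abs_le.1 ((Complex.abs_re_le_norm (ζ - z₁)).trans hζ.le))
    have him := (abs_le.1 ((Complex.abs_im_le_norm (ζ - z₁)).trans hζ.le))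
    have hsq : (ζ - z₁).re ^ 2 + (ζ - z₁).im ^ 2 = r ^ 2 := by
      rw [← hζ, Complex.sq_norm, Complex.normSq_apply]; ring
    simp only [Complex.sub_re, Complex.sub_im] at hre him hsq
    have hm : w ζ ≤ w z₁ := hmax ⟨⟨by linarith, by linarith⟩, ⟨by linarith, by linarith⟩⟩
    have hFre : (F ζ).re = u z₁ - δ * r ^ 2
        - 2 * δ * (z₁.re * (ζ.re - z₁.re) + z₁.im * (ζ.im - z₁.im)) := by
      simp only [F, Complex.sub_re, Complex.ofReal_re, Complex.ofReal_im, Complex.mul_re,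
        Complex.conj_re, Complex.conj_im, Complex.sub_im]
      ring
    rw [hFre, ← hsq]
    simp only [hw] at hm
    linear_combination hm
  have h8 := (hu.le_circleAverage z₁ r hr0).trans hle
  rw [circleAverage_re hF] at h8
  simp only [F, sub_self, mul_zero, sub_zero, Complex.ofReal_re] at h8
  have : 0 < δ * r ^ 2 := by positivity
  linarith

/-- A Phragmén–Lindelöf principle on a half strip. -/
theorem IsSubmean.le_of_halfStrip {u : ℂ → ℝ} (hu : IsSubmean u) {Θ M A B : ℝ}
    (hΘ0 : 0 < Θ) (hΘ : Θ < Real.pi / 2)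
    (hg : ∀ z : ℂ, 0 ≤ z.re → 0 ≤ z.im → z.im ≤ Θ → u z ≤ A + B * Real.exp (2 * z.re))
    (hb : ∀ z : ℂ, 0 ≤ z.re → 0 ≤ z.im → z.im ≤ Θ →
      (z.re = 0 ∨ z.im = 0 ∨ z.im = Θ) → u z ≤ M)
    {z : ℂ} (h1 : 0 ≤ z.re) (h3 : 0 ≤ z.im) (h4 : z.im ≤ Θ) : u z ≤ M := by
  have hpi := Real.pi_pos
  -- The midpoint of `2` and `π / Θ`: above `2` so that `cosh (ρ Re)` beats the admitted growth,
  -- below `π / Θ` so that the cosine stays positive across the strip.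
  obtain ⟨ρ, hρ2, hρ⟩ : ∃ ρ : ℝ, 2 < ρ ∧ ρ * Θ < Real.pi := by
    refine ⟨1 + Real.pi / 2 / Θ, ?_, ?_⟩
    · have : 1 < Real.pi / 2 / Θ := (one_lt_div hΘ0).2 hΘ
      linarith
    · rw [add_mul, div_mul_cancel₀ _ hΘ0.ne']; linarith
  set c₀ := Real.cos (ρ * Θ / 2) with hc₀
  have hρΘ : 0 < ρ * Θ := by positivity
  have hc₀pos : 0 < c₀ := Real.cos_pos_of_mem_Ioo ⟨by linarith, by linarith⟩
  let G : ℂ → ℂ := fun ζ => Complex.cosh (ρ * (ζ - (Θ / 2 : ℝ) * Complex.I))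
  have hG : Differentiable ℂ G := by fun_prop
  have hGre : ∀ ζ : ℂ, (G ζ).re = Real.cosh (ρ * ζ.re) * Real.cos (ρ * (ζ.im - Θ / 2)) := by
    intro ζ
    have : (ρ : ℂ) * (ζ - (Θ / 2 : ℝ) * Complex.I)
        = ((ρ * ζ.re : ℝ) : ℂ) + ((ρ * (ζ.im - Θ / 2) : ℝ) : ℂ) * Complex.I := by
      apply Complex.ext <;> simp
    simp only [G]
    rw [this, Complex.cosh_add, Complex.cosh_mul_I, Complex.sinh_mul_I, ← Complex.ofReal_cosh,
      ← Complex.ofReal_cos, ← Complex.ofReal_sinh, ← Complex.ofReal_sin]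
    simp only [Complex.add_re, Complex.mul_re, Complex.mul_im, Complex.ofReal_re,
      Complex.ofReal_im, Complex.I_re, Complex.I_im]
    ring
  have hGge : ∀ ζ : ℂ, 0 ≤ ζ.im → ζ.im ≤ Θ → c₀ * Real.cosh (ρ * ζ.re) ≤ (G ζ).re := by
    intro ζ h5 h6
    rw [hGre, mul_comm]
    refine mul_le_mul_of_nonneg_left ?_ (Real.cosh_pos _).le
    rw [← Real.cos_abs (ρ * (ζ.im - Θ / 2))]
    refine Real.cos_le_cos_of_nonneg_of_le_pi (abs_nonneg _) (by linarith) ?_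
    rw [abs_le]
    constructor <;> nlinarith
  have key : ∀ δ : ℝ, 0 < δ → u z ≤ M + δ * (G z).re := by
    intro δ hδ
    have hlim : Filter.Tendsto (fun R : ℝ => Real.exp (2 * R) *
        (δ * c₀ / 2 * Real.exp ((ρ - 2) * R) - |B|) - (A - M)) Filter.atTop Filter.atTop := by
      refine Filter.tendsto_atTop_add_const_right _ _ ?_
      refine Filter.Tendsto.atTop_mul_atTop₀ ?_ ?_
      · exact Real.tendsto_exp_atTop.comp (Filter.tendsto_id.const_mul_atTop two_pos)
      · refine Filter.tendsto_atTop_add_const_right _ _ ?_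
        refine Filter.Tendsto.const_mul_atTop (by positivity) ?_
        exact Real.tendsto_exp_atTop.comp (Filter.tendsto_id.const_mul_atTop (by linarith))
    obtain ⟨R, hR0, hRz⟩ := ((hlim.eventually_ge_atTop 0).and
      (Filter.eventually_ge_atTop z.re)).exists
    let H : ℂ → ℂ := fun ζ => -(δ : ℂ) * G ζ
    have hH : Differentiable ℂ H := hG.const_mul _
    have hHre : ∀ ζ, (H ζ).re = -(δ * (G ζ).re) := fun ζ => by simp [H]
    have hw := hu.add (isSubmean_re hH)
    -- Subtracting `δ Re G` makes the far side `Re ζ = R` harmless for large `R`; the rectangle case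
    -- applies, and then `δ` tends to `0`.
    have : u z + (H z).re ≤ M := by
      refine hw.le_of_rect (R := R) (Θ := Θ) ?_ h1 hRz h3 h4
      intro ζ e1 e2 e3 e4 e5
      have hpos : 0 ≤ δ * (c₀ * Real.cosh (ρ * ζ.re)) := by
        have := Real.cosh_pos (ρ * ζ.re)
        positivity
      have hge := mul_le_mul_of_nonneg_left (hGge ζ e3 e4) hδ.le
      rw [hHre]
      by_cases hR : ζ.re = R
      · have h9 := hg ζ e1 e3 e4
        rw [hR] at h9 hge
        have h10 : Real.exp (ρ * R) / 2 ≤ Real.cosh (ρ * R) := by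
          rw [Real.cosh_eq]
          have := Real.exp_pos (-(ρ * R))
          linarith
        have h11 : Real.exp (ρ * R) = Real.exp (2 * R) * Real.exp ((ρ - 2) * R) := by
          rw [← Real.exp_add]; ring_nf
        have h12 := mul_le_mul_of_nonneg_left h10 (by positivity : 0 ≤ δ * c₀)
        rw [h11] at h12
        have h13 := mul_le_mul_of_nonneg_right (le_abs_self B) (Real.exp_pos (2 * R)).le
        linarith
      · have := hb ζ e1 e3 e4 (by tauto)
        linarith
    rw [hHre] at this
    linarith
  have hGpos : 0 < (G z).re :=
    lt_of_lt_of_le (mul_pos hc₀pos (Real.cosh_pos _)) (hGge z h3 h4)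
  refine le_of_forall_pos_le_add fun ε hε => ?_
  have := key (ε / (G z).re) (div_pos hε hGpos)
  rwa [div_mul_cancel₀ _ hGpos.ne'] at this

/-! ### Miyachi's lemma: segment means in a quadrant -/

/-- The mean of `log⁺ |h|` over the horizontal segment `[z - 1, z + 1]` (times its length). -/
noncomputable def segMean (h : ℂ → ℂ) (z : ℂ) : ℝ :=
  ∫ s in (-1 : ℝ)..1, Real.posLog ‖h (z + s)‖

theorem continuous_posLog_norm_add {h : ℂ → ℂ} (hh : Differentiable ℂ h) {g : ℂ → ℂ}
    (hg : Continuous g) : Continuous fun p : ℂ × ℝ => Real.posLog ‖h (g p.1 + p.2)‖ := by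
  have := hh.continuous
  exact Real.continuous_posLog.comp (by fun_prop)

/-- Fubini: the function is an integral over `s` of the subharmonic functions `log⁺|h(e^ζ + s)|`.
The exponential coordinate opens sectors into half strips. -/
theorem isSubmean_segMean_exp {h : ℂ → ℂ} (hh : Differentiable ℂ h) :
    IsSubmean fun ζ => segMean h (Complex.exp ζ) := by
  have hc := continuous_posLog_norm_add hh Complex.continuous_exp
  refine ⟨intervalIntegral.continuous_parametric_intervalIntegral_of_continuous' hc _ _,
    fun c r hr => ?_⟩
  have hc2 : Continuous fun p : ℝ × ℝ =>
      Real.posLog ‖h (Complex.exp (circleMap c r p.1) + p.2)‖ :=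
    hc.comp (((continuous_circleMap c r).comp continuous_fst).prodMk continuous_snd)
  have hswap : Real.circleAverage (fun ζ => segMean h (Complex.exp ζ)) c r
      = ∫ s in (-1 : ℝ)..1,
        Real.circleAverage (fun ζ => Real.posLog ‖h (Complex.exp ζ + s)‖) c r := by
    simp only [Real.circleAverage_def, segMean, smul_eq_mul]
    rw [intervalIntegral.integral_const_mul, intervalIntegral_intervalIntegral_swap]
    exact (hc2.continuousOn.integrableOn_compact (isCompact_uIcc.prod isCompact_uIcc)).mono_set
      (Set.prod_mono Set.uIoc_subset_uIcc Set.uIoc_subset_uIcc)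
  have hc3 : Continuous fun p : ℝ × ℝ =>
      Real.posLog ‖h (Complex.exp (circleMap c r p.2) + p.1)‖ :=
    hc.comp (((continuous_circleMap c r).comp continuous_snd).prodMk continuous_fst)
  have havg : Continuous fun s : ℝ =>
      Real.circleAverage (fun ζ => Real.posLog ‖h (Complex.exp ζ + s)‖) c r := by
    have hI : Continuous fun s : ℝ => ∫ θ in (0 : ℝ)..2 * Real.pi,
        Real.posLog ‖h (Complex.exp (circleMap c r θ) + s)‖ :=
      intervalIntegral.continuous_parametric_intervalIntegral_of_continuous'
        (f := fun (s : ℝ) (θ : ℝ) => Real.posLog ‖h (Complex.exp (circleMap c r θ) + s)‖)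
        hc3 _ _
    exact continuous_const.mul hI
  rw [hswap]
  refine intervalIntegral.integral_mono_on (by norm_num) ?_ ?_ fun s _ => ?_
  · exact (hc.comp (Continuous.prodMk_right c)).intervalIntegrable _ _
  · exact havg.intervalIntegrable _ _
  · have hd : Differentiable ℂ fun ζ => h (Complex.exp ζ + s) :=
      hh.comp (Complex.differentiable_exp.add_const _)
    exact (isSubmean_posLog_norm hd).le_circleAverage c r hr

theorem segMean_le {h : ℂ → ℂ} (hh : Differentiable ℂ h) {z : ℂ} {K : ℝ}
    (hK : ∀ s : ℝ, |s| ≤ 1 → Real.posLog ‖h (z + s)‖ ≤ K) : segMean h z ≤ 2 * K := by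
  have hc := (continuous_posLog_norm_add hh continuous_id).comp (Continuous.prodMk_right z)
  calc segMean h z ≤ ∫ s in (-1 : ℝ)..1, K := by
        refine intervalIntegral.integral_mono_on (by norm_num) (hc.intervalIntegrable _ _)
          (by simp) fun s hs => hK s (abs_le.2 hs)
    _ = 2 * K := by simp; norm_num

/-- Order two growth controlled by the real part, with a polynomial factor. -/
structure GrowthBound (h : ℂ → ℂ) (A N B : ℝ) : Prop where
  differentiable : Differentiable ℂ h
  nonneg : 0 ≤ A ∧ 0 ≤ N ∧ 0 ≤ B
  le : ∀ z : ℂ, Real.posLog ‖h z‖ ≤ A + N * Real.log (1 + ‖z‖) + B * z.re ^ 2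

theorem norm_ofReal_le {s : ℝ} (hs : |s| ≤ 1) : ‖(s : ℂ)‖ ≤ 1 := by simpa using hs

theorem GrowthBound.segMean_le_of_one_le {h : ℂ → ℂ} {A N B : ℝ} (hh : GrowthBound h A N B)
    {z : ℂ} (hz : 1 ≤ ‖z‖) :
    segMean h z ≤ 2 * (A + N * Real.log 3 + 2 * B) + 2 * N * Real.log ‖z‖
      + 4 * B * z.re ^ 2 := by
  obtain ⟨hA, hN, hB⟩ := hh.nonneg
  have := segMean_le hh.differentiable (z := z)
    (K := A + N * (Real.log 3 + Real.log ‖z‖) + B * (2 * z.re ^ 2 + 2)) ?_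
  · linarith
  intro s hs
  refine (hh.le _).trans ?_
  have h1 : ‖z + s‖ ≤ ‖z‖ + 1 := (norm_add_le _ _).trans (by gcongr; exact norm_ofReal_le hs)
  gcongr
  · rw [← Real.log_mul (by norm_num) (by positivity)]
    exact Real.log_le_log (by positivity) (by linarith)
  · have : s ^ 2 ≤ 1 := (sq_le_one_iff_abs_le_one s).2 hs
    simp only [Complex.add_re, Complex.ofReal_re]
    nlinarith [sq_nonneg (z.re - s)]

theorem GrowthBound.segMean_le_of_le_one {h : ℂ → ℂ} {A N B : ℝ} (hh : GrowthBound h A N B)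
    {z : ℂ} (hz : ‖z‖ ≤ 1) :
    segMean h z ≤ 2 * (A + N * Real.log 3 + 4 * B) := by
  obtain ⟨hA, hN, hB⟩ := hh.nonneg
  refine segMean_le hh.differentiable fun s hs => (hh.le _).trans ?_
  have h1 : ‖z + s‖ ≤ 2 := (norm_add_le _ _).trans (by linarith [norm_ofReal_le hs])
  have h2 := (Complex.abs_re_le_norm (z + s)).trans h1
  have h3 : (z + s).re ^ 2 ≤ 4 := by
    rw [← sq_abs]
    nlinarith [abs_nonneg (z + s).re]
  have h4 : Real.log (1 + ‖z + s‖) ≤ Real.log 3 :=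
    Real.log_le_log (by positivity) (by linarith)
  nlinarith [mul_le_mul_of_nonneg_left h3 hB, mul_le_mul_of_nonneg_left h4 hN]

/-- Order two is the borderline for a quadrant, so Phragmén–Lindelöf is applied in a slightly
smaller sector. There the correction `ε Im(z²)`, nonnegative in the quadrant and zero on the real
axis, absorbs the quadratic growth on the upper ray; finally `ε` tends to `0`. This works because
the growth involves only `Re z`, which is small relative to `|z|` near the imaginary axis. -/
theorem GrowthBound.segMean_exp_le {h : ℂ → ℂ} {A N B L : ℝ} (hh : GrowthBound h A N B)
    (hL : ∀ x : ℝ, segMean h x ≤ L) (hL0 : 0 ≤ L) {ζ : ℂ} (h1 : 0 ≤ ζ.re) (h2 : 0 ≤ ζ.im)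
    (h3 : ζ.im < Real.pi / 2) :
    segMean h (Complex.exp ζ) ≤
      L + 2 * (A + N * Real.log 3 + 2 * B) + 4 * B + 2 * N * ζ.re := by
  obtain ⟨hA, hN, hB⟩ := hh.nonneg
  have hlog3 : 0 ≤ N * Real.log 3 := mul_nonneg hN (Real.log_nonneg (by norm_num))
  have hbase : ∀ w : ℂ, 0 ≤ w.re → segMean h (Complex.exp w) ≤
      2 * (A + N * Real.log 3 + 2 * B) + 2 * N * w.re
        + 4 * B * (Real.exp w.re * Real.cos w.im) ^ 2 := by
    intro w hw
    have := hh.segMean_le_of_one_le (z := Complex.exp w) (by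
      rw [Complex.norm_exp]; exact Real.one_le_exp hw)
    rwa [Complex.norm_exp, Real.log_exp, Complex.exp_re] at this
  set M := L + 2 * (A + N * Real.log 3 + 2 * B) + 4 * B with hM
  have key : ∀ ε : ℝ, 0 < ε → segMean h (Complex.exp ζ) ≤
      M + 2 * N * ζ.re + ε * (Complex.exp (2 * ζ)).im := by
    intro ε hε
    -- For `Θ` near `π/2` the cosine is small. The inequality is what makes `4B (Re z)² ≤ ε Im(z²)`
    -- on the ray of angle `Θ`.
    obtain ⟨Θ, hΘζ, hΘpi, hΘ⟩ : ∃ Θ : ℝ, ζ.im < Θ ∧ Θ < Real.pi / 2 ∧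
        2 * B * Real.cos Θ ≤ ε * Real.sin Θ := by
      have hcont : Continuous fun t : ℝ => ε * Real.sin t - 2 * B * Real.cos t := by fun_prop
      have hev : ∀ᶠ t in nhds (Real.pi / 2), 0 < ε * Real.sin t - 2 * B * Real.cos t :=
        hcont.continuousAt.eventually_const_lt (by simpa using hε)
      have h4 : ∀ᶠ t in nhdsWithin (Real.pi / 2) (Set.Iio (Real.pi / 2)),
          ζ.im < t ∧ t < Real.pi / 2 := Ioo_mem_nhdsLT h3
      obtain ⟨t, ⟨ht1, ht2⟩, ht3⟩ := (h4.and (hev.filter_mono nhdsWithin_le_nhds)).exists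
      exact ⟨t, ht1, ht2, by linarith⟩
    have hΘ0 : 0 < Θ := h2.trans_lt hΘζ
    -- The linear term removes the logarithmic growth `2N log|z|`; the second has real part `-ε
    -- Im(z²)` for `z = e^w`.
    let F : ℂ → ℂ := fun w => -(2 * N : ℝ) * w + (ε : ℂ) * Complex.I * Complex.exp (2 * w)
    have hF : Differentiable ℂ F := by fun_prop
    have him : ∀ w : ℂ, (Complex.exp (2 * w)).im
        = Real.exp (2 * w.re) * (2 * Real.sin w.im * Real.cos w.im) := by
      intro w
      rw [Complex.exp_im, ← Real.sin_two_mul]; simp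
    have hFre : ∀ w, (F w).re = -(2 * N * w.re) - ε * (Complex.exp (2 * w)).im := by
      intro w
      simp only [F, Complex.add_re, Complex.neg_re, Complex.mul_re, Complex.neg_im,
        Complex.ofReal_re, Complex.ofReal_im, Complex.I_re, Complex.I_im, Complex.mul_im]
      ring
    have hsub := (isSubmean_segMean_exp hh.differentiable).add (isSubmean_re hF)
    have himnn : ∀ w : ℂ, 0 ≤ w.im → w.im ≤ Θ → 0 ≤ (Complex.exp (2 * w)).im := by
      intro w h5 h6
      have h7 := Real.sin_nonneg_of_nonneg_of_le_pi h5 (by linarith)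
      have h8 := Real.cos_nonneg_of_neg_pi_div_two_le_of_le (by linarith : -(Real.pi / 2) ≤ w.im)
        (by linarith)
      rw [him]; positivity
    have hres : segMean h (Complex.exp ζ) + (F ζ).re ≤ M := by
      refine hsub.le_of_halfStrip (A := 2 * (A + N * Real.log 3 + 2 * B)) (B := 4 * B)
        hΘ0 hΘpi ?_ ?_ h1 h2 hΘζ.le
      · intro w h5 h6 h7
        have h8 := mul_nonneg hε.le (himnn w h6 h7)
        have h9 := hbase w h5
        have h10 : (Real.exp w.re * Real.cos w.im) ^ 2 ≤ Real.exp (2 * w.re) := by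
          rw [mul_pow, ← Real.exp_nat_mul, Nat.cast_two]
          exact mul_le_of_le_one_right (Real.exp_pos _).le (Real.cos_sq_le_one _)
        rw [hFre]
        nlinarith [mul_le_mul_of_nonneg_left h10 (by linarith : 0 ≤ 4 * B)]
      · intro w h5 h6 h7 h8
        have h9 := himnn w h6 h7
        rw [hFre]
        rcases h8 with h8 | h8 | h8
        · have h10 := hbase w h5
          have h11 := mul_nonneg hε.le h9
          have h12 : 4 * B * (Real.exp w.re * Real.cos w.im) ^ 2 ≤ 4 * B := by
            rw [h8, Real.exp_zero, one_mul]
            exact mul_le_of_le_one_right (by linarith) (Real.cos_sq_le_one _)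
          linarith
        · have h10 : Complex.exp w = ((Real.exp w.re : ℝ) : ℂ) := by
            apply Complex.ext
            · rw [Complex.exp_re, h8, Complex.ofReal_re]; simp
            · rw [Complex.exp_im, h8]; simp
          have h11 := hL (Real.exp w.re)
          rw [← h10] at h11
          have h12 : 0 ≤ 2 * N * w.re := by positivity
          have h13 := mul_nonneg hε.le h9
          linarith
        · have h10 := hbase w h5
          have hcos : 0 ≤ Real.cos w.im := by
            rw [h8]; exact Real.cos_nonneg_of_neg_pi_div_two_le_of_le (by linarith) hΘpi.le
          have h11 : 4 * B * (Real.exp w.re * Real.cos w.im) ^ 2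
              ≤ ε * (Complex.exp (2 * w)).im := by
            have h12 : Real.exp (2 * w.re) = Real.exp w.re ^ 2 := by
              rw [← Real.exp_nat_mul, Nat.cast_two]
            have h13 := mul_le_mul_of_nonneg_right hΘ
              (by positivity : 0 ≤ 2 * Real.cos w.im * Real.exp w.re ^ 2)
            rw [← h8] at h13
            rw [him, h12]
            linarith
          linarith
    rw [hFre] at hres
    linarith
  set c := (Complex.exp (2 * ζ)).im with hc
  refine le_of_forall_pos_le_add fun η hη => ?_
  have h5 := key (η / (|c| + 1)) (by positivity)
  have h6 : η / (|c| + 1) * c ≤ η := by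
    rw [div_mul_eq_mul_div, div_le_iff₀ (by positivity)]
    nlinarith [le_abs_self c]
  linarith

/-- On the imaginary axis the growth bound suffices, since `Re z = 0`; elsewhere in the quadrant
`log z` lies in the half strip. -/
theorem GrowthBound.segMean_le_of_quadrant {h : ℂ → ℂ} {A N B L : ℝ} (hh : GrowthBound h A N B)
    (hL : ∀ x : ℝ, segMean h x ≤ L) (hL0 : 0 ≤ L) {z : ℂ} (h1 : 0 ≤ z.re) (h2 : 0 ≤ z.im)
    (hz : 1 ≤ ‖z‖) :
    segMean h z ≤ L + 2 * (A + N * Real.log 3 + 2 * B) + 4 * B + 2 * N * Real.log ‖z‖ := by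
  obtain ⟨hA, hN, hB⟩ := hh.nonneg
  rcases h1.eq_or_lt with h0 | h0
  · have := hh.segMean_le_of_one_le hz
    rw [← h0] at this
    linarith
  have hne : z ≠ 0 := by rintro rfl; simp at h0
  have harg : z.arg < Real.pi / 2 :=
    (abs_lt.1 (Complex.abs_arg_lt_pi_div_two_iff.2 (Or.inl h0))).2
  have := hh.segMean_exp_le hL hL0 (ζ := Complex.log z)
    (by rw [Complex.log_re]; exact Real.log_nonneg hz)
    (by rw [Complex.log_im]; exact Complex.arg_nonneg_iff.2 h2) (by rw [Complex.log_im]; exact harg)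
  rwa [Complex.exp_log hne, Complex.log_re] at this

theorem segMean_comp_neg (h : ℂ → ℂ) (z : ℂ) : segMean (fun w => h (-w)) z = segMean h (-z) := by
  have := intervalIntegral.integral_comp_neg (a := -1) (b := 1)
    (fun s : ℝ => Real.posLog ‖h (-z + s)‖)
  simp only [neg_neg] at this
  rw [segMean, segMean, ← this]
  congr 1; ext s; congr 3; push_cast; ring

theorem segMean_conj (h : ℂ → ℂ) (z : ℂ) :
    segMean (fun w => (starRingEnd ℂ) (h ((starRingEnd ℂ) w))) z
      = segMean h ((starRingEnd ℂ) z) := by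
  simp [segMean]

theorem GrowthBound.comp_neg {h : ℂ → ℂ} {A N B : ℝ} (hh : GrowthBound h A N B) :
    GrowthBound (fun w => h (-w)) A N B :=
  ⟨hh.differentiable.comp differentiable_neg, hh.nonneg, fun z => by simpa using hh.le (-z)⟩

theorem GrowthBound.conj {h : ℂ → ℂ} {A N B : ℝ} (hh : GrowthBound h A N B) :
    GrowthBound (fun w => (starRingEnd ℂ) (h ((starRingEnd ℂ) w))) A N B :=
  ⟨fun z => by
      have := (hh.differentiable ((starRingEnd ℂ) z)).conj_conj
      rwa [Complex.conj_conj] at this, hh.nonneg,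
    fun z => by simpa using hh.le ((starRingEnd ℂ) z)⟩

/-- Reflection `z ↦ -z` and complex conjugation preserve both hypotheses and carry every quadrant to
the first one; the unit disc is covered directly. -/
theorem GrowthBound.segMean_le_log {h : ℂ → ℂ} {A N B L : ℝ} (hh : GrowthBound h A N B)
    (hL : ∀ x : ℝ, segMean h x ≤ L) (hL0 : 0 ≤ L) (z : ℂ) :
    segMean h z ≤ L + 2 * (A + N * Real.log 3 + 2 * B) + 4 * B + 2 * N * Real.log (1 + ‖z‖) := by
  obtain ⟨hA, hN, hB⟩ := hh.nonneg
  have hmono : 2 * N * Real.log ‖z‖ ≤ 2 * N * Real.log (1 + ‖z‖) := by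
    rcases (norm_nonneg z).eq_or_lt with h | h
    · rw [← h]; simp
    · gcongr; linarith
  rcases le_total ‖z‖ 1 with hz | hz
  · have h1 := hh.segMean_le_of_le_one hz
    have h2 : 0 ≤ N * Real.log (1 + ‖z‖) :=
      mul_nonneg hN (Real.log_nonneg (by linarith [norm_nonneg z]))
    linarith
  have half : ∀ {g : ℂ → ℂ} {w : ℂ}, GrowthBound g A N B → (∀ x : ℝ, segMean g x ≤ L) →
      1 ≤ ‖w‖ → 0 ≤ w.re → segMean g w ≤
        L + 2 * (A + N * Real.log 3 + 2 * B) + 4 * B + 2 * N * Real.log ‖w‖ := by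
    intro g w hg hgL hw hre
    rcases le_total 0 w.im with h | h
    · exact hg.segMean_le_of_quadrant hgL hL0 hre h hw
    · have := hg.conj.segMean_le_of_quadrant (z := (starRingEnd ℂ) w) (L := L)
        (fun x => by rw [segMean_conj, Complex.conj_ofReal]; exact hgL x) hL0 (by simpa using hre)
        (by simpa using h) (by simpa using hw)
      simpa [segMean_conj] using this
  refine le_trans ?_ (by linarith [hmono] : L + 2 * (A + N * Real.log 3 + 2 * B) + 4 * B
    + 2 * N * Real.log ‖z‖ ≤ _)
  rcases le_total 0 z.re with h | h
  · exact half hh hL hz h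
  · have := half (w := -z) hh.comp_neg
      (fun x => by rw [segMean_comp_neg, ← Complex.ofReal_neg]; exact hL (-x))
      (by simpa using hz) (by simpa using h)
    simpa [segMean_comp_neg] using this

/-! ### Miyachi's lemma: from segment means to constants -/

theorem IsSubmean.two_pi_mul_le {u : ℂ → ℝ} (hu : IsSubmean u) (c : ℂ) {r : ℝ} (hr : 0 < r) :
    2 * Real.pi * u c ≤ ∫ θ in Set.Ioo (-Real.pi) Real.pi, u (circleMap c r θ) := by
  have h := hu.le_circleAverage c r hr
  have hpi := Real.pi_pos
  rw [Real.circleAverage_eq_integral_add (-Real.pi), smul_eq_mul,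
    intervalIntegral.integral_comp_add_right (fun θ => u (circleMap c r θ)),
    ← div_eq_inv_mul, le_div_iff₀ (by positivity), zero_add,
    show 2 * Real.pi + -Real.pi = Real.pi by ring,
    intervalIntegral.integral_of_le (by linarith), integral_Ioc_eq_integral_Ioo] at h
  linarith

/-- Integrating the circle inequality over radii in `(0, 1)` gives the mean over the unit disc, and
nonnegativity allows enlarging the disc to a square. A square is a union of horizontal segments, so
bounds on `segMean` become pointwise. -/
theorem IsSubmean.pi_mul_le_square {u : ℂ → ℝ} (hu : IsSubmean u) (hu0 : ∀ z, 0 ≤ u z) (c : ℂ) :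
    Real.pi * u c ≤ ∫ t in (-1 : ℝ)..1, ∫ s in (-1 : ℝ)..1, u (c + (s + t * Complex.I)) := by
  have hpi := Real.pi_pos
  set f : ℂ → ℝ := (Metric.ball (0 : ℂ) 1).indicator fun w => u (c + w) with hf
  have hcirc : Continuous fun p : ℝ × ℝ => p.1 * u (circleMap c p.1 p.2) := by
    have := hu.continuous
    simp only [circleMap]
    fun_prop
  have hint : IntegrableOn (fun p : ℝ × ℝ => p.1 * u (circleMap c p.1 p.2))
      (Set.Ioo 0 1 ×ˢ Set.Ioo (-Real.pi) Real.pi) :=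
    (hcirc.continuousOn.integrableOn_compact (isCompact_Icc.prod isCompact_Icc)).mono_set
      (Set.prod_mono Set.Ioo_subset_Icc_self Set.Ioo_subset_Icc_self)
  have hlow : Real.pi * u c ≤ ∫ w, f w := by
    rw [← Complex.integral_comp_polarCoord_symm, polarCoord_target,
      setIntegral_eq_of_subset_of_forall_sdiff_eq_zero
        (s := Set.Ioo (0 : ℝ) 1 ×ˢ Set.Ioo (-Real.pi) Real.pi)
        (measurableSet_Ioi.prod measurableSet_Ioo)
        (Set.prod_mono Set.Ioo_subset_Ioi_self subset_rfl)]
    · have hcongr : ∫ p in Set.Ioo (0 : ℝ) 1 ×ˢ Set.Ioo (-Real.pi) Real.pi,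
          p.1 • f (Complex.polarCoord.symm p)
          = ∫ p in Set.Ioo (0 : ℝ) 1 ×ˢ Set.Ioo (-Real.pi) Real.pi,
            p.1 * u (circleMap c p.1 p.2) := by
        refine setIntegral_congr_fun (measurableSet_Ioo.prod measurableSet_Ioo) ?_
        rintro ⟨r, θ⟩ ⟨⟨hr0, hr1⟩, -⟩
        have hmem : Complex.polarCoord.symm (r, θ) ∈ Metric.ball (0 : ℂ) 1 := by
          simpa [abs_of_pos hr0] using hr1
        simp only [hf, Set.indicator_of_mem hmem, smul_eq_mul]
        simp only [Complex.polarCoord_symm_apply, circleMap, Complex.exp_mul_I,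
          Complex.ofReal_cos, Complex.ofReal_sin]
      rw [hcongr, Measure.volume_eq_prod, setIntegral_prod _ hint]
      have h1 : Real.pi * u c = ∫ r in Set.Ioo (0 : ℝ) 1, r * (2 * Real.pi * u c) := by
        rw [← integral_Ioc_eq_integral_Ioo, ← intervalIntegral.integral_of_le zero_le_one]
        simp; ring
      rw [h1]
      refine setIntegral_mono_on ?_ ?_ measurableSet_Ioo fun r hr => ?_
      · exact ((by fun_prop : Continuous fun r : ℝ => r * (2 * Real.pi * u c)).continuousOn
          |>.integrableOn_compact isCompact_Icc).mono_set Set.Ioo_subset_Icc_self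
      · rw [IntegrableOn, Measure.volume_eq_prod, ← Measure.prod_restrict] at hint
        exact hint.integral_prod_left
      · rw [integral_const_mul]
        exact mul_le_mul_of_nonneg_left (hu.two_pi_mul_le c hr.1) hr.1.le
    · rintro ⟨r, θ⟩ ⟨⟨hr0, hθ⟩, hr1⟩
      have hr0' : 0 < r := hr0
      have hnot : Complex.polarCoord.symm (r, θ) ∉ Metric.ball (0 : ℂ) 1 := by
        simp only [mem_ball_zero_iff, Complex.norm_polarCoord_symm, abs_of_pos hr0', not_lt]
        by_contra! hlt
        exact hr1 ⟨⟨hr0, hlt⟩, hθ⟩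
      simp only [hf]
      rw [Set.indicator_of_notMem hnot, smul_zero]
  refine hlow.trans ?_
  have hcs : Continuous fun p : ℝ × ℝ => u (c + (p.1 + p.2 * Complex.I)) := by
    have := hu.continuous
    fun_prop
  have hints : IntegrableOn (fun p : ℝ × ℝ => u (c + (p.1 + p.2 * Complex.I)))
      (Set.Icc (-1) 1 ×ˢ Set.Icc (-1) 1) :=
    hcs.continuousOn.integrableOn_compact (isCompact_Icc.prod isCompact_Icc)
  have hsub : Set.Ioc (-1 : ℝ) 1 ×ˢ Set.Ioc (-1 : ℝ) 1 ⊆ Set.Icc (-1) 1 ×ˢ Set.Icc (-1) 1 :=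
    Set.prod_mono Set.Ioc_subset_Icc_self Set.Ioc_subset_Icc_self
  have hsquare : ∫ p in Set.Icc (-1 : ℝ) 1 ×ˢ Set.Icc (-1 : ℝ) 1,
      u (c + (p.1 + p.2 * Complex.I))
      = ∫ t in (-1 : ℝ)..1, ∫ s in (-1 : ℝ)..1, u (c + (s + t * Complex.I)) := by
    rw [← intervalIntegral_intervalIntegral_swap
      (F := fun s t : ℝ => u (c + (s + t * Complex.I)))]
    · rw [Measure.volume_eq_prod] at hints ⊢
      rw [setIntegral_prod _ hints]
      simp only [intervalIntegral.integral_of_le (show (-1 : ℝ) ≤ 1 by norm_num),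
        integral_Icc_eq_integral_Ioc]
    · rw [Set.uIoc_of_le (by norm_num)]
      exact hints.mono_set hsub
  rw [← Complex.volume_preserving_equiv_real_prod.symm.integral_comp
    Complex.measurableEquivRealProd.symm.measurableEmbedding, ← hsquare,
    ← integral_indicator (measurableSet_Icc.prod measurableSet_Icc)]
  refine integral_mono_of_nonneg (Filter.Eventually.of_forall fun p => ?_)
    (hints.integrable_indicator (measurableSet_Icc.prod measurableSet_Icc))
    (Filter.Eventually.of_forall fun p => ?_)
  · exact Set.indicator_nonneg (fun _ _ => hu0 _) _
  · have hp : Complex.measurableEquivRealProd.symm p = p.1 + p.2 * Complex.I := by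
      apply Complex.ext <;> simp [Complex.measurableEquivRealProd]
    simp only [hf, hp]
    by_cases hmem : (p.1 + p.2 * Complex.I : ℂ) ∈ Metric.ball (0 : ℂ) 1
    · have hlt := mem_ball_zero_iff.1 hmem
      have h1 := (Complex.abs_re_le_norm _).trans hlt.le
      have h2 := (Complex.abs_im_le_norm _).trans hlt.le
      simp only [Complex.add_re, Complex.ofReal_re, Complex.re_ofReal_mul, Complex.I_re,
        Complex.add_im, Complex.ofReal_im, Complex.im_ofReal_mul, Complex.I_im, mul_zero,
        mul_one, add_zero, zero_add] at h1 h2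
      have hmem' : p ∈ Set.Icc (-1 : ℝ) 1 ×ˢ Set.Icc (-1 : ℝ) 1 := ⟨abs_le.1 h1, abs_le.1 h2⟩
      rw [Set.indicator_of_mem hmem, Set.indicator_of_mem hmem']
    · rw [Set.indicator_of_notMem hmem]
      exact Set.indicator_nonneg (fun _ _ => hu0 _) _

/-- An entire function of polynomial growth is a polynomial. -/
theorem exists_polynomial_of_norm_le {h : ℂ → ℂ} (hh : Differentiable ℂ h) {K : ℝ} {m : ℕ}
    (hK : ∀ z, ‖h z‖ ≤ K * (2 + ‖z‖) ^ m) : ∃ P : Polynomial ℂ, ∀ z, h z = P.eval z := by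
  have hzero : ∀ j, m < j → iteratedDeriv j h 0 = 0 := by
    intro j hj
    -- Cauchy's estimate on the circle of radius `R`, where `2 + R ≤ 2R`; since `j > m` at least one
    -- factor `R⁻¹` remains as `R` grows.
    have hbound : ∀ R : ℝ, 2 ≤ R → ‖iteratedDeriv j h 0‖ ≤ j.factorial * (K * 2 ^ m) * R⁻¹ := by
      intro R hR
      have hR0 : 0 < R := by linarith
      have hK0 : 0 ≤ K := by
        have := (norm_nonneg _).trans (hK 0)
        exact nonneg_of_mul_nonneg_left this (by positivity)
      have := Complex.norm_iteratedDeriv_le_of_forall_mem_sphere_norm_le j hR0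
        (hh.diffContOnCl (s := Metric.ball 0 R)) (C := K * (2 * R) ^ m) fun z hz => by
          rw [mem_sphere_zero_iff_norm] at hz
          refine (hK z).trans ?_
          rw [hz]
          gcongr
          linarith
      refine this.trans ?_
      obtain ⟨i, rfl⟩ := Nat.exists_eq_add_of_lt hj
      rw [div_le_iff₀ (by positivity), mul_pow, pow_succ, pow_add]
      have h1 : 1 ≤ R ^ i := one_le_pow₀ (by linarith)
      have h2 : (0 : ℝ) ≤ (m + i + 1).factorial * (K * 2 ^ m) * R ^ m := by positivity
      calc ((m + i + 1).factorial : ℝ) * (K * (2 ^ m * R ^ m))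
          ≤ (m + i + 1).factorial * (K * 2 ^ m) * R ^ m * R ^ i := by
            nlinarith [mul_le_mul_of_nonneg_left h1 h2]
        _ = _ := by field_simp
    have hlim : Filter.Tendsto (fun R : ℝ => j.factorial * (K * 2 ^ m) * R⁻¹) Filter.atTop
        (nhds 0) := by simpa using tendsto_inv_atTop_zero.const_mul (j.factorial * (K * 2 ^ m))
    have := ge_of_tendsto hlim ((Filter.eventually_ge_atTop 2).mono hbound)
    exact norm_le_zero_iff.1 this
  refine ⟨∑ j ∈ Finset.range (m + 1),
    Polynomial.C ((j.factorial : ℂ)⁻¹ * iteratedDeriv j h 0) * Polynomial.X ^ j, fun z => ?_⟩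
  have hs := Complex.hasSum_taylorSeries_of_entire hh 0 z
  have hs' := hasSum_sum_of_ne_finset_zero (L := SummationFilter.unconditional ℕ) (f := fun j : ℕ =>
    (j.factorial : ℂ)⁻¹ • (z - 0) ^ j • iteratedDeriv j h 0) (s := Finset.range (m + 1)) (by
      intro j hj
      rw [hzero j (by simpa [Nat.lt_succ_iff] using hj)]; simp)
  rw [hs.unique hs', Polynomial.eval_finsetSum]
  refine Finset.sum_congr rfl fun j _ => ?_
  simp; ring

theorem lintegral_ofReal_const_eq_top {s : Set ℝ} (hs : volume s = ⊤) {g : ℝ → ℝ} {ε : ℝ}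
    (hε : 0 < ε) (hg : ∀ x ∈ s, ε ≤ g x) (hm : MeasurableSet s) :
    ∫⁻ x in s, ENNReal.ofReal (g x) = ⊤ := by
  refine top_le_iff.1 ?_
  calc (⊤ : ℝ≥0∞) = ∫⁻ _ in s, ENNReal.ofReal ε := by
        rw [setLIntegral_const, hs, ENNReal.mul_top (by simpa using hε)]
    _ ≤ _ := setLIntegral_mono' hm fun x hx => ENNReal.ofReal_le_ofReal (hg x hx)

/-- **Miyachi's lemma**, with a polynomial loss in the growth condition. -/
theorem GrowthBound.eq_const {h : ℂ → ℂ} {A N B : ℝ} (hh : GrowthBound h A N B)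
    (hint : ∫⁻ x : ℝ, ENNReal.ofReal (Real.posLog ‖h x‖) < ⊤) :
    ∃ c : ℂ, ‖c‖ ≤ 1 ∧ ∀ z, h z = c := by
  obtain ⟨hA, hN, hB⟩ := hh.nonneg
  have hd := hh.differentiable
  have hcR : Continuous fun x : ℝ => Real.posLog ‖h x‖ :=
    Real.continuous_posLog.comp (by have := hd.continuous; fun_prop)
  have hi : Integrable fun x : ℝ => Real.posLog ‖h x‖ :=
    ⟨hcR.aestronglyMeasurable, by
      rw [hasFiniteIntegral_iff_ofReal (Filter.Eventually.of_forall fun _ => Real.posLog_nonneg)]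
      exact hint⟩
  set L := ∫ x : ℝ, Real.posLog ‖h x‖ with hLdef
  have hL0 : 0 ≤ L := integral_nonneg fun _ => Real.posLog_nonneg
  have hL : ∀ x : ℝ, segMean h x ≤ L := by
    intro x
    have h1 : segMean h x = ∫ t in (x + -1)..(x + 1), Real.posLog ‖h t‖ := by
      rw [← intervalIntegral.integral_comp_add_left (fun t : ℝ => Real.posLog ‖h t‖) x, segMean]
      simp
    rw [h1, intervalIntegral.integral_of_le (by linarith)]
    exact setIntegral_le_integral hi (Filter.Eventually.of_forall fun _ => Real.posLog_nonneg)
  set M := L + 2 * (A + N * Real.log 3 + 2 * B) + 4 * B with hM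
  have hseg := hh.segMean_le_log hL hL0
  -- Integrating the segment bound over heights `t ∈ [-1, 1]` controls the square mean; the factor
  -- `π ≥ 1` is dropped.
  have hpoint : ∀ z, Real.posLog ‖h z‖ ≤ 2 * M + 4 * N * Real.log (2 + ‖z‖) := by
    intro z
    have h1 := (isSubmean_posLog_norm hd).pi_mul_le_square (fun _ => Real.posLog_nonneg) z
    have h2 : ∀ t ∈ Set.Icc (-1 : ℝ) 1,
        ∫ s in (-1 : ℝ)..1, Real.posLog ‖h (z + (s + t * Complex.I))‖
          ≤ M + 2 * N * Real.log (2 + ‖z‖) := by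
      intro t ht
      have h3 := hseg (z + t * Complex.I)
      have h4 : ‖z + t * Complex.I‖ ≤ ‖z‖ + 1 :=
        (norm_add_le _ _).trans (by gcongr; simpa using abs_le.2 ht)
      have h5 : Real.log (1 + ‖z + t * Complex.I‖) ≤ Real.log (2 + ‖z‖) :=
        Real.log_le_log (by positivity) (by linarith)
      have h6 := mul_le_mul_of_nonneg_left h5 (by linarith : 0 ≤ 2 * N)
      have h7 : ∫ s in (-1 : ℝ)..1, Real.posLog ‖h (z + (s + t * Complex.I))‖
          = segMean h (z + t * Complex.I) := by
        rw [segMean]; congr 1; ext s; congr 3; ring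
      rw [h7]; linarith
    have h3 : ∫ t in (-1 : ℝ)..1, ∫ s in (-1 : ℝ)..1,
        Real.posLog ‖h (z + (s + t * Complex.I))‖ ≤
        ∫ t in (-1 : ℝ)..1, (M + 2 * N * Real.log (2 + ‖z‖)) := by
      refine intervalIntegral.integral_mono_on (by norm_num) ?_ (by simp) h2
      refine Continuous.intervalIntegrable ?_ _ _
      refine intervalIntegral.continuous_parametric_intervalIntegral_of_continuous' ?_ _ _
      have := hd.continuous
      exact Real.continuous_posLog.comp (by fun_prop)
    rw [intervalIntegral.integral_const, smul_eq_mul] at h3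
    have h4 : Real.posLog ‖h z‖ ≤ Real.pi * Real.posLog ‖h z‖ :=
      le_mul_of_one_le_left Real.posLog_nonneg (by linarith [Real.pi_gt_three])
    linarith
  obtain ⟨m, hm⟩ := exists_nat_ge (4 * N)
  obtain ⟨P, hP⟩ := exists_polynomial_of_norm_le hd (K := Real.exp (2 * M)) (m := m) (by
    intro z
    have hl : 0 ≤ Real.log (2 + ‖z‖) := Real.log_nonneg (by linarith [norm_nonneg z])
    have h1 : Real.log ‖h z‖ ≤ 2 * M + m * Real.log (2 + ‖z‖) :=
      (le_max_right _ _).trans ((hpoint z).trans (by gcongr))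
    rcases (norm_nonneg (h z)).eq_or_lt with h0 | h0
    · rw [← h0]; positivity
    · rw [← Real.exp_log h0]
      refine (Real.exp_le_exp.2 h1).trans_eq ?_
      rw [Real.exp_add, ← Real.log_pow, Real.exp_log (by positivity)])
  -- A nonconstant polynomial tends to infinity in modulus along the real axis, so `log⁺` would be
  -- at least `1` on a half line.
  have hdeg : P.degree ≤ 0 := by
    by_contra! hdeg
    have ht := P.tendsto_norm_atTop hdeg (l := Filter.atTop) (z := fun x : ℝ => (x : ℂ))
      (by simpa using Filter.tendsto_abs_atTop_atTop)
    obtain ⟨R, hR⟩ := Filter.eventually_atTop.1 (ht.eventually_ge_atTop (Real.exp 1))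
    refine hint.ne (top_le_iff.1 ?_)
    rw [← lintegral_ofReal_const_eq_top (s := Set.Ici R) (g := fun x : ℝ => Real.posLog ‖h x‖)
      Real.volume_Ici one_pos ?_ measurableSet_Ici]
    · exact setLIntegral_le_lintegral _ _
    · intro x hx
      rw [hP, Real.posLog_apply]
      refine le_max_of_le_right ?_
      rw [← Real.log_exp 1]
      exact Real.log_le_log (Real.exp_pos 1) (hR x hx)
  obtain ⟨c, hc⟩ : ∃ c, ∀ z, h z = c :=
    ⟨P.coeff 0, fun z => by rw [hP, Polynomial.eq_C_of_degree_le_zero hdeg]; simp⟩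
  refine ⟨c, ?_, hc⟩
  by_contra! hc1
  refine hint.ne (top_le_iff.1 ?_)
  rw [← lintegral_ofReal_const_eq_top (s := Set.univ) (g := fun x : ℝ => Real.posLog ‖h x‖)
    Real.volume_univ (Real.log_pos hc1) ?_ MeasurableSet.univ]
  · exact setLIntegral_le_lintegral _ _
  · intro x _
    rw [hc]
    exact le_max_right _ _

/-! ### Normalized Bessel functions -/

/-- The ratio between the Taylor coefficients of `j_α` and those of the cosine. -/
noncomputable def besselMoment (α : ℝ) (m : ℕ) : ℝ :=
  Real.Gamma (α + 1) * Real.Gamma (m + 1 / 2) / (Real.Gamma (1 / 2) * Real.Gamma (α + m + 1))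

theorem besselMoment_zero {α : ℝ} (hα : -(1 / 2) ≤ α) : besselMoment α 0 = 1 := by
  have h1 : Real.Gamma (α + 1) ≠ 0 := (Real.Gamma_pos_of_pos (by linarith)).ne'
  have h2 : Real.Gamma (1 / 2) ≠ 0 := (Real.Gamma_pos_of_pos (by norm_num)).ne'
  simp only [besselMoment, Nat.cast_zero, zero_add, add_zero]
  field_simp

theorem besselMoment_succ {α : ℝ} (hα : -(1 / 2) ≤ α) (m : ℕ) :
    besselMoment α (m + 1) = besselMoment α m * ((m + 1 / 2) / (α + m + 1)) := by
  have hm : (0 : ℝ) ≤ m := m.cast_nonneg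
  have h1 : (0 : ℝ) < α + m + 1 := by linarith
  have h2 : Real.Gamma (1 / 2) ≠ 0 := (Real.Gamma_pos_of_pos (by norm_num)).ne'
  have h3 : Real.Gamma (α + m + 1) ≠ 0 := (Real.Gamma_pos_of_pos h1).ne'
  have e1 : Real.Gamma ((m : ℝ) + 1 + 1 / 2) = (m + 1 / 2) * Real.Gamma (m + 1 / 2) := by
    rw [← Real.Gamma_add_one (by positivity)]; ring_nf
  have e2 : Real.Gamma (α + (m + 1) + 1) = (α + m + 1) * Real.Gamma (α + m + 1) := by
    rw [← Real.Gamma_add_one h1.ne']; ring_nf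
  simp only [besselMoment, Nat.cast_succ]
  rw [e1, e2]
  field_simp

theorem besselMoment_pos {α : ℝ} (hα : -(1 / 2) ≤ α) (m : ℕ) : 0 < besselMoment α m := by
  have hm : (0 : ℝ) ≤ m := m.cast_nonneg
  have h1 := Real.Gamma_pos_of_pos (by linarith : 0 < α + 1)
  have h2 := Real.Gamma_pos_of_pos (by norm_num : (0 : ℝ) < 1 / 2)
  have h3 := Real.Gamma_pos_of_pos (by linarith : 0 < α + m + 1)
  have h4 := Real.Gamma_pos_of_pos (by linarith : (0 : ℝ) < m + 1 / 2)
  unfold besselMoment; positivity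

theorem besselMoment_le_one {α : ℝ} (hα : -(1 / 2) ≤ α) (m : ℕ) : besselMoment α m ≤ 1 := by
  induction m with
  | zero => exact (besselMoment_zero hα).le
  | succ m ih =>
    have hm : (0 : ℝ) ≤ m := m.cast_nonneg
    rw [besselMoment_succ hα]
    refine mul_le_one₀ ih (div_nonneg (by positivity) (by linarith)) ?_
    rw [div_le_one (by linarith)]
    linarith

/-- The duplication formula at integers; it converts the Bessel coefficients into cosine
coefficients times `besselMoment`. -/
theorem Gamma_nat_add_half_mul (m : ℕ) :
    Real.Gamma (m + 1 / 2) * (4 ^ m * m.factorial) = Real.Gamma (1 / 2) * (2 * m).factorial := by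
  induction m with
  | zero => simp
  | succ m ih =>
    have e1 : Real.Gamma (((m + 1 : ℕ) : ℝ) + 1 / 2) = (m + 1 / 2) * Real.Gamma (m + 1 / 2) := by
      rw [← Real.Gamma_add_one (by positivity)]; push_cast; ring_nf
    rw [e1, show 2 * (m + 1) = 2 * m + 1 + 1 by ring, Nat.factorial_succ (2 * m + 1),
      Nat.factorial_succ (2 * m), Nat.factorial_succ m]
    push_cast
    linear_combination (4 * (m + 1 / 2) * (m + 1)) * ih

/-- The Taylor coefficients of `j_α`. -/
noncomputable def besselCoeff (α : ℝ) (m : ℕ) : ℝ :=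
  (-1) ^ m * besselMoment α m / (2 * m).factorial

theorem besselCoeff_eq {α : ℝ} (m : ℕ) :
    besselCoeff α m = Real.Gamma (α + 1) *
      ((-1) ^ m / ((m.factorial : ℝ) * Real.Gamma (α + m + 1))) / 4 ^ m := by
  have h := Gamma_nat_add_half_mul m
  have h2 : Real.Gamma (1 / 2) ≠ 0 := (Real.Gamma_pos_of_pos (by norm_num)).ne'
  have h3 : ((2 * m).factorial : ℝ) ≠ 0 := by positivity
  have h4 : (m.factorial : ℝ) ≠ 0 := by positivity
  unfold besselCoeff besselMoment
  by_cases h5 : Real.Gamma (α + m + 1) = 0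
  · simp [h5]
  generalize Real.Gamma (m + 1 / 2) = g at h ⊢
  field_simp
  linear_combination Real.Gamma (α + 1) * h

theorem besselCoeff_ne_zero {α : ℝ} (hα : -(1 / 2) ≤ α) (m : ℕ) : besselCoeff α m ≠ 0 := by
  have := besselMoment_pos hα m
  unfold besselCoeff
  positivity

theorem abs_besselCoeff_le {α : ℝ} (hα : -(1 / 2) ≤ α) (m : ℕ) :
    |besselCoeff α m| ≤ 1 / (2 * m).factorial := by
  unfold besselCoeff
  rw [abs_div, abs_mul, abs_pow, abs_neg, abs_one, one_pow, one_mul,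
    abs_of_pos (besselMoment_pos hα m), Nat.abs_cast]
  gcongr
  exact besselMoment_le_one hα m

theorem norm_besselCoeff_mul_le {α : ℝ} (hα : -(1 / 2) ≤ α) (z : ℂ) (m : ℕ) :
    ‖(besselCoeff α m : ℂ) * z ^ (2 * m)‖ ≤ ‖z‖ ^ (2 * m) / (2 * m).factorial := by
  rw [norm_mul, norm_pow, Complex.norm_real, Real.norm_eq_abs, div_eq_mul_one_div, mul_comm]
  gcongr
  exact abs_besselCoeff_le hα m

theorem summable_norm_besselCoeff {α : ℝ} (hα : -(1 / 2) ≤ α) (z : ℂ) :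
    Summable fun m : ℕ => ‖(besselCoeff α m : ℂ) * z ^ (2 * m)‖ :=
  Summable.of_nonneg_of_le (fun _ => norm_nonneg _) (norm_besselCoeff_mul_le hα z)
    (Real.hasSum_cosh ‖z‖).summable

theorem hasSum_besselj {α : ℝ} (hα : -(1 / 2) ≤ α) (z : ℂ) :
    HasSum (fun m : ℕ => (besselCoeff α m : ℂ) * z ^ (2 * m)) (besselj α z) := by
  have h := (summable_norm_besselCoeff hα z).of_norm.hasSum
  suffices hj : besselj α z = ∑' m : ℕ, (besselCoeff α m : ℂ) * z ^ (2 * m) by rwa [hj]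
  rw [besselj, ← tsum_mul_left]
  refine tsum_congr fun m => ?_
  rw [besselCoeff_eq, div_pow, pow_mul 2]
  push_cast
  norm_num
  ring

theorem norm_cos_le_exp (w : ℂ) : ‖Complex.cos w‖ ≤ Real.exp |w.im| := by
  rw [Complex.cos, norm_div, Complex.norm_two, div_le_iff₀ two_pos]
  refine (norm_add_le _ _).trans ?_
  rw [Complex.norm_exp, Complex.norm_exp]
  have h1 : (w * Complex.I).re ≤ |w.im| := by simpa using neg_le_abs w.im
  have h2 : (-w * Complex.I).re ≤ |w.im| := by simpa using le_abs_self w.im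
  linarith [Real.exp_le_exp.2 h1, Real.exp_le_exp.2 h2]

theorem measurable_betaPDF (a b : ℝ) : Measurable (ProbabilityTheory.betaPDF a b) :=
  (ProbabilityTheory.measurable_betaPDFReal a b).ennreal_ofReal

theorem integral_betaPDFReal {a b : ℝ} (ha : 0 < a) (hb : 0 < b) :
    ∫ x, ProbabilityTheory.betaPDFReal a b x = 1 := by
  have hnn : ∀ x, 0 ≤ ProbabilityTheory.betaPDFReal a b x := by
    intro x
    by_cases h : 0 < x ∧ x < 1
    · exact (ProbabilityTheory.betaPDFReal_pos h.1 h.2 ha hb).le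
    · rw [ProbabilityTheory.betaPDFReal, if_neg h]
  rw [integral_eq_lintegral_of_nonneg_ae (Filter.Eventually.of_forall hnn)
    (ProbabilityTheory.measurable_betaPDFReal a b).aestronglyMeasurable]
  have := ProbabilityTheory.lintegral_betaPDF_eq_one ha hb
  simp only [ProbabilityTheory.betaPDF] at this
  rw [this, ENNReal.toReal_one]

/-- Multiplying the beta density of parameters `(1/2, b)` by `x^m` gives that of `(m + 1/2, b)` up
to a ratio of beta functions. -/
theorem integral_pow_betaMeasure {b : ℝ} (hb : 0 < b) (m : ℕ) :
    ∫ x, x ^ m ∂(ProbabilityTheory.betaMeasure (1 / 2) b) = besselMoment (b - 1 / 2) m := by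
  have hm : (0 : ℝ) ≤ m := m.cast_nonneg
  have hnn : ∀ x, 0 ≤ ProbabilityTheory.betaPDFReal (1 / 2) b x := by
    intro x
    by_cases h : 0 < x ∧ x < 1
    · exact (ProbabilityTheory.betaPDFReal_pos h.1 h.2 (by norm_num) hb).le
    · rw [ProbabilityTheory.betaPDFReal, if_neg h]
  have hmom : besselMoment (b - 1 / 2) m
      = ProbabilityTheory.beta (m + 1 / 2) b / ProbabilityTheory.beta (1 / 2) b := by
    have h1 := (Real.Gamma_pos_of_pos hb).ne'
    have h2 := (Real.Gamma_pos_of_pos (by norm_num : (0 : ℝ) < 1 / 2)).ne'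
    have h3 := (Real.Gamma_pos_of_pos (by linarith : 0 < 1 / 2 + b)).ne'
    have h4 := (Real.Gamma_pos_of_pos (by linarith : 0 < (m : ℝ) + 1 / 2 + b)).ne'
    rw [besselMoment, ProbabilityTheory.beta, ProbabilityTheory.beta,
      show b - 1 / 2 + 1 = 1 / 2 + b by ring,
      show b - 1 / 2 + m + 1 = m + 1 / 2 + b by ring]
    field_simp
  rw [ProbabilityTheory.betaMeasure, integral_withDensity_eq_integral_toReal_smul
    (measurable_betaPDF _ _)
    (Filter.Eventually.of_forall fun _ => ENNReal.ofReal_lt_top), hmom]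
  have : ∀ x : ℝ, (ProbabilityTheory.betaPDF (1 / 2) b x).toReal • x ^ m
      = ProbabilityTheory.beta (m + 1 / 2) b / ProbabilityTheory.beta (1 / 2) b
        * ProbabilityTheory.betaPDFReal (m + 1 / 2) b x := by
    intro x
    rw [ProbabilityTheory.betaPDF, ENNReal.toReal_ofReal (hnn x), smul_eq_mul]
    by_cases h : 0 < x ∧ x < 1
    · have h1 := (ProbabilityTheory.beta_pos (by linarith : (0 : ℝ) < m + 1 / 2) hb).ne'
      have h2 := (ProbabilityTheory.beta_pos (by norm_num : (0 : ℝ) < 1 / 2) hb).ne'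
      rw [ProbabilityTheory.betaPDFReal, if_pos h, ProbabilityTheory.betaPDFReal, if_pos h,
        show (m : ℝ) + 1 / 2 - 1 = m + (1 / 2 - 1) by ring, Real.rpow_add h.1, Real.rpow_natCast]
      generalize ProbabilityTheory.beta ((m : ℝ) + 1 / 2) b = b₁ at h1 ⊢
      generalize ProbabilityTheory.beta (1 / 2) b = b₂ at h2 ⊢
      field_simp
    · rw [ProbabilityTheory.betaPDFReal, if_neg h, ProbabilityTheory.betaPDFReal, if_neg h]
      simp
  simp_rw [this]
  rw [integral_const_mul, integral_betaPDFReal (by linarith) hb, mul_one]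

/-- `j_α` is an average of dilated cosines. -/
theorem exists_measure_besselMoment {α : ℝ} (hα : -(1 / 2) ≤ α) :
    ∃ β : Measure ℝ, IsProbabilityMeasure β ∧ (∀ᵐ x ∂β, x ∈ Set.Icc (0 : ℝ) 1) ∧
      ∀ m : ℕ, ∫ x, x ^ m ∂β = besselMoment α m := by
  rcases hα.eq_or_lt with h | h
  -- At `α = -1/2` the second beta parameter `α + 1/2` is `0`; the law degenerates to the point mass
  -- at `1` and `j_α` is the cosine.
  · refine ⟨Measure.dirac 1, inferInstance, ?_, fun m => ?_⟩
    · rw [ae_dirac_eq]; simp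
    · rw [integral_dirac, one_pow]
      have h1 := (Real.Gamma_pos_of_pos (by norm_num : (0 : ℝ) < 1 / 2)).ne'
      have h2 := (Real.Gamma_pos_of_pos (by positivity : (0 : ℝ) < m + 1 / 2)).ne'
      rw [besselMoment, ← h, show -(1 / 2 : ℝ) + m + 1 = m + 1 / 2 by ring,
        show -(1 / 2 : ℝ) + 1 = 1 / 2 by ring, div_self (mul_ne_zero h1 h2)]
  · have hb : 0 < α + 1 / 2 := by linarith
    refine ⟨ProbabilityTheory.betaMeasure (1 / 2) (α + 1 / 2),
      ProbabilityTheory.isProbabilityMeasureBeta (by norm_num) hb, ?_, fun m => ?_⟩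
    · rw [ProbabilityTheory.betaMeasure, ae_withDensity_iff
        (measurable_betaPDF _ _)]
      refine Filter.Eventually.of_forall fun x hx => ?_
      by_contra hx'
      refine hx ?_
      rw [ProbabilityTheory.betaPDF_eq, if_neg, ENNReal.ofReal_zero]
      exact fun h => hx' ⟨h.1.le, h.2.le⟩
    · rw [integral_pow_betaMeasure hb]; congr 1; ring

/-- Integrating the cosine series termwise gives `j_α(z) = ∫ cos(z √x) dβ(x)` for a probability `β`
on `[0, 1]`, and `|cos w| ≤ e^|Im w|`. The sharp rate, with constant `1`, is needed in the critical
case. -/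
theorem norm_besselj_le {α : ℝ} (hα : -(1 / 2) ≤ α) (z : ℂ) :
    ‖besselj α z‖ ≤ Real.exp |z.im| := by
  obtain ⟨β, hβ, hsupp, hmom⟩ := exists_measure_besselMoment hα
  let F : ℕ → ℝ → ℂ := fun m x => ((-1) ^ m * z ^ (2 * m) / (2 * m).factorial) * ((x ^ m : ℝ) : ℂ)
  have hxi : ∀ m : ℕ, Integrable (fun x : ℝ => x ^ m) β := by
    intro m
    refine Integrable.mono' (integrable_const (1 : ℝ))
      (by fun_prop : Measurable fun x : ℝ => x ^ m).aestronglyMeasurable ?_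
    filter_upwards [hsupp] with x hx
    rw [norm_pow, Real.norm_of_nonneg hx.1]
    exact pow_le_one₀ hx.1 hx.2
  have hFi : ∀ m, Integrable (F m) β := fun m => ((hxi m).ofReal).const_mul _
  have hFint : ∀ m, ∫ x, F m x ∂β = (besselCoeff α m : ℂ) * z ^ (2 * m) := by
    intro m
    simp only [F]
    rw [integral_const_mul, integral_complex_ofReal, hmom, besselCoeff]
    push_cast
    ring
  have hFn : ∀ m, ∫ x, ‖F m x‖ ∂β = ‖(besselCoeff α m : ℂ) * z ^ (2 * m)‖ := by
    intro m
    have hc := besselMoment_pos hα m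
    have : ∫ x, ‖F m x‖ ∂β = ∫ x, (‖z‖ ^ (2 * m) / (2 * m).factorial) * x ^ m ∂β := by
      refine integral_congr_ae ?_
      filter_upwards [hsupp] with x hx
      simp only [F, norm_mul, norm_div, norm_pow, norm_neg, norm_one, one_pow, one_mul,
        Complex.norm_real, Complex.norm_natCast, Real.norm_of_nonneg hx.1]
    rw [this, integral_const_mul, hmom, besselCoeff, norm_mul, norm_pow, Complex.norm_real,
      norm_div, norm_mul, norm_pow, norm_neg, norm_one, one_pow, one_mul,
      Real.norm_of_nonneg hc.le, Real.norm_of_nonneg (Nat.cast_nonneg _)]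
    ring
  have hsum := hasSum_integral_of_summable_integral_norm hFi
    (by simp_rw [hFn]; exact summable_norm_besselCoeff hα z)
  simp_rw [hFint] at hsum
  rw [(hasSum_besselj hα z).unique hsum]
  have hcos : ∀ᵐ x ∂β, ‖∑' m, F m x‖ ≤ Real.exp |z.im| := by
    filter_upwards [hsupp] with x hx
    have h1 : ∑' m, F m x = Complex.cos (z * (Real.sqrt x : ℝ)) := by
      rw [← (Complex.hasSum_cos (z * (Real.sqrt x : ℝ))).tsum_eq]
      refine tsum_congr fun m => ?_
      have : ((Real.sqrt x : ℝ) : ℂ) ^ (2 * m) = ((x ^ m : ℝ) : ℂ) := by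
        rw [← Complex.ofReal_pow, pow_mul, Real.sq_sqrt hx.1]
      simp only [F]
      rw [mul_pow, this]
      ring
    rw [h1]
    refine (norm_cos_le_exp _).trans (Real.exp_le_exp.2 ?_)
    rw [Complex.im_mul_ofReal, abs_mul, abs_of_nonneg (Real.sqrt_nonneg x)]
    exact mul_le_of_le_one_right (abs_nonneg _) (Real.sqrt_le_one.2 hx.2)
  have := norm_integral_le_of_norm_le_const hcos
  simpa using this

/-! ### The measure in radial coordinates -/

/-- The radial variable `|x|^(1/n)`. -/
noncomputable def rad (n : ℕ) (x : ℝ) : ℝ := |x| ^ (1 / (n : ℝ))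

theorem rad_nonneg (n : ℕ) (x : ℝ) : 0 ≤ rad n x := Real.rpow_nonneg (abs_nonneg x) _

theorem rad_neg (n : ℕ) (x : ℝ) : rad n (-x) = rad n x := by simp [rad]

theorem rad_mul (n : ℕ) (x y : ℝ) : rad n (y * x) = rad n y * rad n x := by
  rw [rad, abs_mul, Real.mul_rpow (abs_nonneg _) (abs_nonneg _)]; rfl

theorem rad_pow {n : ℕ} (hn : 0 < n) (x : ℝ) : rad n x ^ n = |x| := by
  rw [rad, one_div]; exact Real.rpow_inv_natCast_pow (abs_nonneg x) hn.ne'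

theorem rad_of_pow {n : ℕ} (hn : 0 < n) {s : ℝ} (hs : 0 ≤ s) : rad n (s ^ n) = s := by
  rw [rad, abs_of_nonneg (by positivity), one_div]
  exact Real.pow_rpow_inv_natCast hs hn.ne'

theorem rad_sq (n : ℕ) (x : ℝ) : |x| ^ (2 / (n : ℝ)) = rad n x ^ 2 := by
  rw [rad, ← Real.rpow_natCast (|x| ^ (1 / (n : ℝ))), ← Real.rpow_mul (abs_nonneg _)]
  congr 1; push_cast; ring

theorem continuous_rad (n : ℕ) : Continuous (rad n) :=
  continuous_abs.rpow_const fun _ => Or.inr (by positivity)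

theorem neg_half_le_index {n : ℕ} (hn : 0 < n) {k : ℝ} (hk : ((n : ℝ) - 1) / (2 * n) ≤ k) :
    -(1 / 2) ≤ index n k := by
  have hn' : (0 : ℝ) < n := by exact_mod_cast hn
  rw [div_le_iff₀ (by positivity)] at hk
  unfold index
  linarith

theorem neg_half_le_index_add {n : ℕ} (hn : 0 < n) {k : ℝ} (hk : ((n : ℝ) - 1) / (2 * n) ≤ k) :
    -(1 / 2) ≤ index n k + n := by
  have := neg_half_le_index hn hk
  have : (0 : ℝ) ≤ n := n.cast_nonneg
  linarith

/-- The constant of the radial density of `mu`. -/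
noncomputable def radConst (n : ℕ) (k : ℝ) : ℝ :=
  (n / 2 : ℝ) ^ index n k * n / Real.Gamma (index n k + 1)

theorem radConst_pos {n : ℕ} (hn : 0 < n) {k : ℝ} (hk : ((n : ℝ) - 1) / (2 * n) ≤ k) :
    0 < radConst n k := by
  have hn' : (0 : ℝ) < n := by exact_mod_cast hn
  have := Real.Gamma_pos_of_pos (by linarith [neg_half_le_index hn hk] : 0 < index n k + 1)
  unfold radConst; positivity

theorem measurable_mu_density (n : ℕ) (k : ℝ) : Measurable fun x : ℝ =>
    ENNReal.ofReal (1 / (2 * Real.Gamma (index n k + 1)) * (n / 2 : ℝ) ^ index n k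
      * |x| ^ (2 * k + 2 / (n : ℝ) - 2)) := by
  have : Measurable fun x : ℝ => |x| ^ (2 * k + 2 / (n : ℝ) - 2) :=
    measurable_id.abs.pow_const _
  exact (this.const_mul _).ennreal_ofReal

/-- Substitution `x = s^n`: the exponents combine as `n(2k + 2/n - 2) + (n - 1) = 2α + 1`. The half
of `radConst` is the share of one half line. -/
theorem lintegral_Ioi_mu {n : ℕ} (hn : 0 < n) {k : ℝ} (hk : ((n : ℝ) - 1) / (2 * n) ≤ k)
    {g : ℝ → ℝ≥0∞} (hg : Measurable g) :
    ∫⁻ x in Set.Ioi 0, g (rad n x) ∂(mu n k) =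
      ∫⁻ s in Set.Ioi 0, ENNReal.ofReal (radConst n k / 2 * s ^ (2 * index n k + 1)) * g s := by
  have hn' : (0 : ℝ) < n := by exact_mod_cast hn
  have hmeas : Measurable fun x => g (rad n x) := hg.comp (continuous_rad n).measurable
  rw [mu, setLIntegral_withDensity_eq_setLIntegral_mul _ (measurable_mu_density n k) hmeas
    measurableSet_Ioi]
  have himg : (fun s : ℝ => s ^ n) '' Set.Ioi 0 = Set.Ioi 0 := by
    ext x
    constructor
    · rintro ⟨s, hs, rfl⟩; exact pow_pos (Set.mem_Ioi.1 hs) n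
    · intro hx
      have hx' : (0 : ℝ) < x := hx
      refine ⟨rad n x, Real.rpow_pos_of_pos (abs_pos.2 hx'.ne') _, ?_⟩
      simp only [rad_pow hn, abs_of_pos hx']
  have hinj : Set.InjOn (fun s : ℝ => s ^ n) (Set.Ioi 0) := by
    intro s hs t ht h
    exact (pow_left_inj₀ (le_of_lt hs) (le_of_lt ht) hn.ne').1 h
  have hcv := lintegral_image_eq_lintegral_abs_deriv_mul (f := fun s : ℝ => s ^ n)
    (f' := fun s => n * s ^ (n - 1)) measurableSet_Ioi
    (fun s _ => (hasDerivAt_pow n s).hasDerivWithinAt) hinj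
    (fun x => ENNReal.ofReal (1 / (2 * Real.Gamma (index n k + 1)) * (n / 2 : ℝ) ^ index n k
      * |x| ^ (2 * k + 2 / (n : ℝ) - 2)) * g (rad n x))
  rw [himg] at hcv
  simp only [Pi.mul_apply]
  rw [hcv]
  refine setLIntegral_congr_fun measurableSet_Ioi fun s hs => ?_
  have hs' : (0 : ℝ) < s := hs
  rw [rad_of_pow hn hs'.le, ← mul_assoc, ← ENNReal.ofReal_mul (abs_nonneg _),
    abs_of_pos (by positivity), abs_of_pos (by positivity)]
  congr 2
  have h1 : (s ^ n : ℝ) ^ (2 * k + 2 / (n : ℝ) - 2) * s ^ (n - 1)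
      = s ^ (2 * index n k + 1) := by
    rw [← Real.rpow_natCast s n, ← Real.rpow_mul hs'.le, ← Real.rpow_natCast s (n - 1),
      ← Real.rpow_add hs', Nat.cast_pred hn, index]
    congr 1
    field_simp
    ring
  rw [← h1, radConst]
  have := (Real.Gamma_pos_of_pos (by linarith [neg_half_le_index hn hk] :
    0 < index n k + 1)).ne'
  field_simp

theorem map_neg_mu (n : ℕ) (k : ℝ) : (mu n k).map (fun x => -x) = mu n k := by
  refine Measure.ext_of_lintegral _ fun f hf => ?_
  rw [lintegral_map hf measurable_neg, mu,
    lintegral_withDensity_eq_lintegral_mul _ (measurable_mu_density n k)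
      (g := fun x => f (-x)) (hf.comp measurable_neg),
    lintegral_withDensity_eq_lintegral_mul _ (measurable_mu_density n k) hf]
  rw [← lintegral_neg_eq_self]
  simp

theorem integral_neg_mu (n : ℕ) (k : ℝ) {E : Type*} [NormedAddCommGroup E] [NormedSpace ℝ E]
    (f : ℝ → E) : ∫ x, f (-x) ∂(mu n k) = ∫ x, f x ∂(mu n k) := by
  conv_rhs => rw [← map_neg_mu n k]
  exact ((MeasurableEquiv.neg ℝ).measurableEmbedding.integral_map f).symm

theorem lintegral_neg_mu (n : ℕ) (k : ℝ) (s : Set ℝ) (hs : MeasurableSet s) (f : ℝ → ℝ≥0∞) :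
    ∫⁻ x in -s, f (-x) ∂(mu n k) = ∫⁻ x in s, f x ∂(mu n k) := by
  conv_rhs => rw [← map_neg_mu n k]
  rw [Measure.restrict_map measurable_neg hs]
  exact ((MeasurableEquiv.neg ℝ).measurableEmbedding.lintegral_map f).symm

theorem integral_eq_zero_of_odd (n : ℕ) (k : ℝ) {f : ℝ → ℂ} (hf : ∀ x, f (-x) = -f x) :
    ∫ x, f x ∂(mu n k) = 0 := by
  have h := integral_neg_mu n k f
  simp only [hf, integral_neg] at h
  exact self_eq_neg.1 h.symm

theorem mu_absolutelyContinuous (n : ℕ) (k : ℝ) : mu n k ≪ volume :=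
  withDensity_absolutelyContinuous _ _

theorem ae_mu_ne_zero (n : ℕ) (k : ℝ) : ∀ᵐ x ∂(mu n k), x ≠ 0 :=
  (mu_absolutelyContinuous n k).ae_le (Measure.ae_ne volume 0)

/-- The density is positive off the origin, so conclusions almost everywhere for `mu` transfer to
Lebesgue measure. -/
theorem volume_absolutelyContinuous {n : ℕ} (hn : 0 < n) {k : ℝ}
    (hk : ((n : ℝ) - 1) / (2 * n) ≤ k) : volume ≪ mu n k := by
  have hn' : (0 : ℝ) < n := by exact_mod_cast hn
  refine withDensity_absolutelyContinuous' (measurable_mu_density n k).aemeasurable ?_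
  filter_upwards [Measure.ae_ne volume (0 : ℝ)] with x hx
  have := Real.Gamma_pos_of_pos (by linarith [neg_half_le_index hn hk] : 0 < index n k + 1)
  have h2 := Real.rpow_pos_of_pos (abs_pos.2 hx) (2 * k + 2 / (n : ℝ) - 2)
  rw [ne_eq, ENNReal.ofReal_eq_zero, not_le]
  positivity

/-- The radial part of `mu`. -/
noncomputable def radMeasure (n : ℕ) (k : ℝ) : Measure ℝ :=
  (volume.restrict (Set.Ioi 0)).withDensity fun s =>
    ENNReal.ofReal (radConst n k * s ^ (2 * index n k + 1))

theorem measurable_radMeasure_density (n : ℕ) (k : ℝ) : Measurable fun s : ℝ =>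
    ENNReal.ofReal (radConst n k * s ^ (2 * index n k + 1)) :=
  ((measurable_id.pow_const _).const_mul _).ennreal_ofReal

theorem map_rad_mu {n : ℕ} (hn : 0 < n) {k : ℝ} (hk : ((n : ℝ) - 1) / (2 * n) ≤ k) :
    (mu n k).map (rad n) = radMeasure n k := by
  refine Measure.ext_of_lintegral _ fun g hg => ?_
  have hK := radConst_pos hn hk
  rw [lintegral_map hg (continuous_rad n).measurable, radMeasure,
    lintegral_withDensity_eq_lintegral_mul _ (measurable_radMeasure_density n k) hg]
  have h1 : ∫⁻ x, g (rad n x) ∂(mu n k)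
      = ∫⁻ x in Set.Ioi 0, g (rad n x) ∂(mu n k) + ∫⁻ x in Set.Iio 0, g (rad n x) ∂(mu n k) := by
    rw [← lintegral_add_compl _ (measurableSet_Ioi (a := (0 : ℝ))), Set.compl_Ioi]
    congr 1
    refine setLIntegral_congr ?_
    exact (mu_absolutelyContinuous n k).ae_le Iio_ae_eq_Iic.symm
  have h2 := lintegral_neg_mu n k (Set.Ioi 0) measurableSet_Ioi (fun x => g (rad n x))
  simp only [rad_neg, Set.neg_Ioi, neg_zero] at h2
  rw [h1, h2, lintegral_Ioi_mu hn hk hg, ← two_mul, ← lintegral_const_mul' _ _ (by simp)]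
  refine setLIntegral_congr_fun measurableSet_Ioi fun s hs => ?_
  simp only [Pi.mul_apply]
  rw [← mul_assoc, ← ENNReal.ofReal_ofNat 2, ← ENNReal.ofReal_mul zero_le_two]
  congr 2
  ring

theorem integrable_radMeasure_iff {n : ℕ} (hn : 0 < n) {k : ℝ}
    (hk : ((n : ℝ) - 1) / (2 * n) ≤ k) {φ : ℝ → ℝ} :
    Integrable φ (radMeasure n k) ↔
      IntegrableOn (fun s => radConst n k * s ^ (2 * index n k + 1) * φ s) (Set.Ioi 0) := by
  have hK := radConst_pos hn hk
  rw [radMeasure, integrable_withDensity_iff_integrable_smul' (measurable_radMeasure_density n k)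
    (Filter.Eventually.of_forall fun _ => ENNReal.ofReal_lt_top), IntegrableOn]
  refine integrable_congr ?_
  filter_upwards [ae_restrict_mem measurableSet_Ioi] with s hs
  have hs' : (0 : ℝ) < s := hs
  rw [ENNReal.toReal_ofReal (by positivity), smul_eq_mul]

theorem integral_radMeasure {n : ℕ} (hn : 0 < n) {k : ℝ}
    (hk : ((n : ℝ) - 1) / (2 * n) ≤ k) {φ : ℝ → ℝ} :
    ∫ s, φ s ∂(radMeasure n k) =
      ∫ s in Set.Ioi 0, radConst n k * s ^ (2 * index n k + 1) * φ s := by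
  have hK := radConst_pos hn hk
  rw [radMeasure, integral_withDensity_eq_integral_toReal_smul (measurable_radMeasure_density n k)
    (Filter.Eventually.of_forall fun _ => ENNReal.ofReal_lt_top)]
  refine setIntegral_congr_fun measurableSet_Ioi fun s hs => ?_
  have hs' : (0 : ℝ) < s := hs
  rw [ENNReal.toReal_ofReal (by positivity), smul_eq_mul]

theorem integrable_rad_iff {n : ℕ} (hn : 0 < n) {k : ℝ}
    (hk : ((n : ℝ) - 1) / (2 * n) ≤ k) {φ : ℝ → ℝ} (hφ : Measurable φ) :
    Integrable (fun x => φ (rad n x)) (mu n k) ↔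
      IntegrableOn (fun s => radConst n k * s ^ (2 * index n k + 1) * φ s) (Set.Ioi 0) := by
  rw [← integrable_radMeasure_iff hn hk, ← map_rad_mu hn hk,
    integrable_map_measure hφ.aestronglyMeasurable (continuous_rad n).aemeasurable]
  rfl

theorem integral_rad {n : ℕ} (hn : 0 < n) {k : ℝ}
    (hk : ((n : ℝ) - 1) / (2 * n) ≤ k) {φ : ℝ → ℝ} (hφ : Measurable φ) :
    ∫ x, φ (rad n x) ∂(mu n k) =
      ∫ s in Set.Ioi 0, radConst n k * s ^ (2 * index n k + 1) * φ s := by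
  rw [← integral_radMeasure hn hk, ← map_rad_mu hn hk,
    integral_map (continuous_rad n).aemeasurable hφ.aestronglyMeasurable]

/-- Near infinity the radial density is bounded below, near zero a continuous function is
integrable anyway. -/
theorem lintegral_Ioi_lt_top_of_weight {c ν : ℝ} (hc : 0 < c) (hν : 0 ≤ ν) {φ : ℝ → ℝ}
    (hφ : Continuous φ)
    (h : ∫⁻ s in Set.Ioi 0, ENNReal.ofReal (c * s ^ ν) * ENNReal.ofReal (φ s) < ⊤) :
    ∫⁻ s in Set.Ioi 0, ENNReal.ofReal (φ s) < ⊤ := by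
  rw [← Set.Ioc_union_Ioi_eq_Ioi (zero_le_one' ℝ), lintegral_union measurableSet_Ioi
    (Set.Ioc_disjoint_Ioi le_rfl)]
  refine ENNReal.add_lt_top.2 ⟨?_, ?_⟩
  · have : IntegrableOn φ (Set.Ioc 0 1) :=
      (hφ.continuousOn.integrableOn_compact isCompact_Icc).mono_set Set.Ioc_subset_Icc_self
    refine lt_of_le_of_lt (lintegral_mono fun s => ?_) this.2
    rw [← ofReal_norm]
    exact ENNReal.ofReal_le_ofReal (le_abs_self _)
  · have h1 : ENNReal.ofReal c * ∫⁻ s in Set.Ioi 1, ENNReal.ofReal (φ s) < ⊤ := by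
      refine lt_of_le_of_lt ?_ h
      rw [← lintegral_const_mul' _ _ ENNReal.ofReal_ne_top]
      refine le_trans ?_ (lintegral_mono_set (Set.Ioi_subset_Ioi zero_le_one))
      refine setLIntegral_mono' measurableSet_Ioi fun s hs => ?_
      gcongr
      exact le_mul_of_one_le_right hc.le (Real.one_le_rpow (le_of_lt hs) hν)
    exact (ENNReal.mul_lt_top_iff.1 h1).elim (fun h => h.2) fun h => h.elim
      (fun h => absurd h (by simpa using hc)) fun h => by rw [h]; exact ENNReal.zero_lt_top

/-! ### Gaussian domination and weighted integrals -/

theorem one_add_abs_pow_mul_exp_le (j : ℕ) {β : ℝ} (hβ : 0 < β) (u : ℝ) :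
    (1 + |u|) ^ j * Real.exp (-(β * u ^ 2)) ≤
      j.factorial * Real.exp (1 + 1 / (2 * β)) * Real.exp (-(β / 2) * u ^ 2) := by
  have h1 : (1 + |u|) ^ j ≤ j.factorial * Real.exp (1 + |u|) := by
    have := Real.pow_div_factorial_le_exp (1 + |u|) (by positivity) j
    rwa [div_le_iff₀' (by positivity)] at this
  calc (1 + |u|) ^ j * Real.exp (-(β * u ^ 2))
      ≤ j.factorial * Real.exp (1 + |u|) * Real.exp (-(β * u ^ 2)) := by gcongr
    _ = j.factorial * Real.exp (1 + |u| - β * u ^ 2) := by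
        rw [mul_assoc, ← Real.exp_add]; ring_nf
    _ ≤ j.factorial * Real.exp (1 + 1 / (2 * β) + -(β / 2) * u ^ 2) := by
        gcongr
        have h2 : |u| ≤ β / 2 * u ^ 2 + 1 / (2 * β) := by
          have h3 : 0 ≤ (β * |u| - 1) ^ 2 / (2 * β) := by positivity
          have h4 : (β * |u| - 1) ^ 2 / (2 * β) = β / 2 * |u| ^ 2 + 1 / (2 * β) - |u| := by
            field_simp; ring
          rw [sq_abs] at h4
          linarith
        linarith
    _ = _ := by rw [Real.exp_add, mul_assoc]

theorem integrable_one_add_abs_pow_mul_exp (j : ℕ) {β : ℝ} (hβ : 0 < β) :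
    Integrable fun u : ℝ => (1 + |u|) ^ j * Real.exp (-(β * u ^ 2)) := by
  refine Integrable.mono' ((integrable_exp_neg_mul_sq (half_pos hβ)).const_mul
    (j.factorial * Real.exp (1 + 1 / (2 * β)))) (by fun_prop) (Filter.Eventually.of_forall fun u => ?_)
  rw [Real.norm_of_nonneg (by positivity)]
  exact one_add_abs_pow_mul_exp_le j hβ u

theorem one_add_le_mul_one_add_abs_sub {s c : ℝ} (hc : 0 ≤ c) :
    1 + s ≤ (1 + c) * (1 + |s - c|) := by
  nlinarith [le_abs_self (s - c), mul_nonneg hc (abs_nonneg (s - c))]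

/-- Shifting the centre of the Gaussian to `c` costs only a power of `1 + c`, because `1 + s ≤ (1 +
c)(1 + |s - c|)` moves the polynomial weight to the centre. -/
theorem exists_radial_gaussian_bound {n : ℕ} (hn : 0 < n) {k : ℝ}
    (hk : ((n : ℝ) - 1) / (2 * n) ≤ k) (j : ℕ) {β : ℝ} (hβ : 0 < β) :
    ∃ (K : ℝ) (N : ℕ), 0 ≤ K ∧ ∀ c : ℝ, 0 ≤ c →
      Integrable (fun x => (1 + rad n x) ^ j * Real.exp (-(β * (rad n x - c) ^ 2))) (mu n k) ∧
      ∫ x, (1 + rad n x) ^ j * Real.exp (-(β * (rad n x - c) ^ 2)) ∂(mu n k)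
        ≤ K * (1 + c) ^ N := by
  have hK := radConst_pos hn hk
  have hα := neg_half_le_index hn hk
  obtain ⟨l, hl⟩ := exists_nat_ge (2 * index n k + 1)
  set J := ∫ u : ℝ, (1 + |u|) ^ (j + l) * Real.exp (-(β * u ^ 2)) with hJ
  have hJ0 : 0 ≤ J := integral_nonneg fun u => by positivity
  refine ⟨radConst n k * J, j + l, by positivity, fun c hc => ?_⟩
  have hφ : Measurable fun s : ℝ => (1 + s) ^ j * Real.exp (-(β * (s - c) ^ 2)) := by fun_prop
  have hdomI : Integrable fun s : ℝ => radConst n k * (1 + c) ^ (j + l) *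
      ((1 + |s - c|) ^ (j + l) * Real.exp (-(β * (s - c) ^ 2))) :=
    ((integrable_one_add_abs_pow_mul_exp (j + l) hβ).comp_sub_right c).const_mul _
  have hle : ∀ s ∈ Set.Ioi (0 : ℝ), radConst n k * s ^ (2 * index n k + 1) *
      ((1 + s) ^ j * Real.exp (-(β * (s - c) ^ 2))) ≤ radConst n k * (1 + c) ^ (j + l) *
      ((1 + |s - c|) ^ (j + l) * Real.exp (-(β * (s - c) ^ 2))) := by
    intro s hs
    have hs' : (0 : ℝ) < s := hs
    have h1 : s ^ (2 * index n k + 1) ≤ (1 + s) ^ l := by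
      rw [← Real.rpow_natCast]
      exact (Real.rpow_le_rpow hs'.le (by linarith) (by linarith)).trans
        (Real.rpow_le_rpow_of_exponent_le (by linarith) hl)
    have h2 : (1 + s) ^ (j + l) ≤ ((1 + c) * (1 + |s - c|)) ^ (j + l) :=
      pow_le_pow_left₀ (by positivity) (one_add_le_mul_one_add_abs_sub hc) _
    calc radConst n k * s ^ (2 * index n k + 1) * ((1 + s) ^ j * Real.exp (-(β * (s - c) ^ 2)))
        ≤ radConst n k * (1 + s) ^ l * ((1 + s) ^ j * Real.exp (-(β * (s - c) ^ 2))) := by gcongr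
      _ = radConst n k * (1 + s) ^ (j + l) * Real.exp (-(β * (s - c) ^ 2)) := by ring
      _ ≤ radConst n k * ((1 + c) * (1 + |s - c|)) ^ (j + l)
          * Real.exp (-(β * (s - c) ^ 2)) := by gcongr
      _ = _ := by rw [mul_pow]; ring
  have hint : IntegrableOn (fun s => radConst n k * s ^ (2 * index n k + 1) *
      ((1 + s) ^ j * Real.exp (-(β * (s - c) ^ 2)))) (Set.Ioi 0) := by
    refine Integrable.mono' hdomI.integrableOn
      (((measurable_id.pow_const _).const_mul _).mul hφ).aestronglyMeasurable ?_
    filter_upwards [ae_restrict_mem measurableSet_Ioi] with s hs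
    have hs' : (0 : ℝ) < s := hs
    rw [Real.norm_of_nonneg (by positivity)]
    exact hle s hs
  refine ⟨(integrable_rad_iff hn hk hφ).2 hint, ?_⟩
  rw [integral_rad hn hk hφ]
  calc _ ≤ ∫ s in Set.Ioi 0, radConst n k * (1 + c) ^ (j + l) *
      ((1 + |s - c|) ^ (j + l) * Real.exp (-(β * (s - c) ^ 2))) :=
        setIntegral_mono_on hint hdomI.integrableOn measurableSet_Ioi hle
    _ ≤ ∫ s, radConst n k * (1 + c) ^ (j + l) *
      ((1 + |s - c|) ^ (j + l) * Real.exp (-(β * (s - c) ^ 2))) :=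
        setIntegral_le_integral hdomI (Filter.Eventually.of_forall fun s => by positivity)
    _ = radConst n k * J * (1 + c) ^ (j + l) := by
        rw [integral_const_mul, integral_sub_right_eq_self
          (fun u : ℝ => (1 + |u|) ^ (j + l) * Real.exp (-(β * u ^ 2)))]
        ring

/-- Functions dominated by `e^(-n a |x|^(2/n))` times the sum of a constant and an integrable
function. -/
structure GaussDom (n : ℕ) (k a : ℝ) (f : ℝ → ℂ) : Prop where
  aestronglyMeasurable : AEStronglyMeasurable f (mu n k)
  exists_bound : ∃ (M : ℝ) (G : ℝ → ℝ), 0 ≤ M ∧ (∀ x, 0 ≤ G x) ∧ Integrable G (mu n k) ∧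
    ∀ᵐ x ∂(mu n k), ‖f x‖ ≤ Real.exp (-(n * a * rad n x ^ 2)) * (M + G x)

/-- Completing the square, `-na s² + nv s = nv²/(4a) - na (s - v/(2a))²`. The exponential rate in
`v` is exact; the weight and the radial measure cost only a power of `1 + v`. -/
theorem GaussDom.exists_integral_le {n : ℕ} (hn : 0 < n) {k : ℝ}
    (hk : ((n : ℝ) - 1) / (2 * n) ≤ k) {a : ℝ} (ha : 0 < a) {f : ℝ → ℂ}
    (hf : GaussDom n k a f) (j : ℕ) :
    ∃ (K : ℝ) (N : ℕ), 0 ≤ K ∧ ∀ v : ℝ, 0 ≤ v →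
      Integrable (fun x => ‖f x‖ * (1 + rad n x) ^ j * Real.exp (n * v * rad n x)) (mu n k) ∧
      ∫ x, ‖f x‖ * (1 + rad n x) ^ j * Real.exp (n * v * rad n x) ∂(mu n k)
        ≤ K * (1 + v) ^ N * Real.exp (n * v ^ 2 / (4 * a)) := by
  have hn' : (0 : ℝ) < n := by exact_mod_cast hn
  obtain ⟨M, G, hM, hG0, hG, hfle⟩ := hf.exists_bound
  have hβ : 0 < n * a := by positivity
  obtain ⟨K, N, hK, hbound⟩ := exists_radial_gaussian_bound hn hk j hβ
  set D : ℝ := j.factorial * Real.exp (1 + 1 / (2 * (n * a))) with hD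
  have hD0 : 0 ≤ D := by positivity
  have hIG : 0 ≤ ∫ x, G x ∂(mu n k) := integral_nonneg hG0
  set r : ℝ := 1 + 1 / (2 * a) with hr
  have hr1 : 1 ≤ r := by rw [hr]; have : 0 < 1 / (2 * a) := by positivity
                         linarith
  refine ⟨(M * K + D * ∫ x, G x ∂(mu n k)) * r ^ (N + j), N + j, by positivity, fun v hv => ?_⟩
  set c := v / (2 * a) with hc
  have hc0 : 0 ≤ c := by positivity
  obtain ⟨hi, hile⟩ := hbound c hc0
  set E := Real.exp (n * v ^ 2 / (4 * a)) with hE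
  have hE0 : 0 < E := Real.exp_pos _
  have hexp : ∀ s : ℝ, Real.exp (-(n * a * s ^ 2)) * Real.exp (n * v * s)
      = E * Real.exp (-(n * a * (s - c) ^ 2)) := by
    intro s
    rw [hE, ← Real.exp_add, ← Real.exp_add, hc]
    congr 1
    field_simp
    ring
  have hdomI : Integrable (fun x => E * (M * ((1 + rad n x) ^ j *
      Real.exp (-(n * a * (rad n x - c) ^ 2))) + D * (1 + c) ^ j * G x)) (mu n k) :=
    ((hi.const_mul M).add (hG.const_mul _)).const_mul E
  have hle : ∀ᵐ x ∂(mu n k), ‖f x‖ * (1 + rad n x) ^ j * Real.exp (n * v * rad n x) ≤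
      E * (M * ((1 + rad n x) ^ j * Real.exp (-(n * a * (rad n x - c) ^ 2)))
        + D * (1 + c) ^ j * G x) := by
    filter_upwards [hfle] with x hx
    have hs := rad_nonneg n x
    set s := rad n x
    have h1 : (1 + s) ^ j * Real.exp (-(n * a * (s - c) ^ 2)) ≤ D * (1 + c) ^ j := by
      have h2 : (1 + s) ^ j ≤ ((1 + c) * (1 + |s - c|)) ^ j :=
        pow_le_pow_left₀ (by positivity) (one_add_le_mul_one_add_abs_sub hc0) _
      have h3 := one_add_abs_pow_mul_exp_le j hβ (s - c)
      have h4 : Real.exp (-(n * a / 2) * (s - c) ^ 2) ≤ 1 :=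
        Real.exp_le_one_iff.2 (by nlinarith [sq_nonneg (s - c)])
      calc (1 + s) ^ j * Real.exp (-(n * a * (s - c) ^ 2))
          ≤ ((1 + c) * (1 + |s - c|)) ^ j * Real.exp (-(n * a * (s - c) ^ 2)) := by gcongr
        _ = (1 + c) ^ j * ((1 + |s - c|) ^ j * Real.exp (-(n * a * (s - c) ^ 2))) := by
            rw [mul_pow]; ring
        _ ≤ (1 + c) ^ j * (D * Real.exp (-(n * a / 2) * (s - c) ^ 2)) := by gcongr
        _ ≤ (1 + c) ^ j * (D * 1) := by gcongr
        _ = _ := by ring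
    calc ‖f x‖ * (1 + s) ^ j * Real.exp (n * v * s)
        ≤ Real.exp (-(n * a * s ^ 2)) * (M + G x) * (1 + s) ^ j * Real.exp (n * v * s) := by
          gcongr
      _ = (M + G x) * (1 + s) ^ j * (Real.exp (-(n * a * s ^ 2)) * Real.exp (n * v * s)) := by
          ring
      _ = E * (M * ((1 + s) ^ j * Real.exp (-(n * a * (s - c) ^ 2)))
          + (1 + s) ^ j * Real.exp (-(n * a * (s - c) ^ 2)) * G x) := by rw [hexp]; ring
      _ ≤ _ := by
          have := hG0 x
          gcongr
  have hmeas : AEStronglyMeasurable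
      (fun x => ‖f x‖ * (1 + rad n x) ^ j * Real.exp (n * v * rad n x)) (mu n k) := by
    have hrc := continuous_rad n
    exact (hf.aestronglyMeasurable.norm.mul
      (by fun_prop : Continuous fun x => (1 + rad n x) ^ j).aestronglyMeasurable).mul
      (by fun_prop : Continuous fun x => Real.exp (n * v * rad n x)).aestronglyMeasurable
  refine ⟨hdomI.mono' hmeas ?_, ?_⟩
  · filter_upwards [hle] with x hx
    have hs := rad_nonneg n x
    rwa [Real.norm_of_nonneg (by positivity)]
  · have h1c : 1 + c ≤ r * (1 + v) := by
      have : 0 ≤ 1 / (2 * a) := by positivity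
      have h2 : c = 1 / (2 * a) * v := by rw [hc]; ring
      rw [hr, h2]
      nlinarith
    have h2 : 1 ≤ 1 + c := by linarith
    calc _ ≤ ∫ x, E * (M * ((1 + rad n x) ^ j *
          Real.exp (-(n * a * (rad n x - c) ^ 2))) + D * (1 + c) ^ j * G x) ∂(mu n k) :=
          integral_mono_of_nonneg (Filter.Eventually.of_forall fun x => by
            have hs := rad_nonneg n x
            positivity) hdomI hle
      _ = E * (M * ∫ x, (1 + rad n x) ^ j * Real.exp (-(n * a * (rad n x - c) ^ 2)) ∂(mu n k)
          + D * (1 + c) ^ j * ∫ x, G x ∂(mu n k)) := by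
          rw [integral_const_mul, integral_add (hi.const_mul M) (hG.const_mul _),
            integral_const_mul, integral_const_mul]
      _ ≤ E * (M * (K * (1 + c) ^ N) + D * (1 + c) ^ j * ∫ x, G x ∂(mu n k)) := by gcongr
      _ ≤ E * (M * (K * (1 + c) ^ (N + j)) + D * (1 + c) ^ (N + j) * ∫ x, G x ∂(mu n k)) := by
          gcongr <;> omega
      _ = (M * K + D * ∫ x, G x ∂(mu n k)) * (1 + c) ^ (N + j) * E := by ring
      _ ≤ (M * K + D * ∫ x, G x ∂(mu n k)) * (r * (1 + v)) ^ (N + j) * E := by gcongr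
      _ = _ := by rw [mul_pow]; ring

/-- For finite `p` use `t ≤ 1 + t^p`; for `p = ∞` the essential supremum. Thus all exponents enter
through the same constant-plus-integrable bound. -/
theorem _root_.MeasureTheory.MemLp.exists_norm_le {μ : Measure ℝ} {g : ℝ → ℂ} {p : ℝ≥0∞}
    (hp : 1 ≤ p) (hg : MemLp g p μ) : ∃ (M : ℝ) (G : ℝ → ℝ), 0 ≤ M ∧ (∀ x, 0 ≤ G x) ∧
      Integrable G μ ∧ ∀ᵐ x ∂μ, ‖g x‖ ≤ M + G x := by
  rcases eq_or_ne p ⊤ with rfl | htop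
  · refine ⟨(eLpNorm g ⊤ μ).toReal, 0, ENNReal.toReal_nonneg, fun _ => le_rfl,
      integrable_zero _ _ _, ?_⟩
    filter_upwards [ae_le_eLpNormEssSup (f := g) (μ := μ)] with x hx
    rw [Pi.zero_apply, add_zero, ← toReal_enorm]
    exact ENNReal.toReal_mono hg.eLpNorm_ne_top (by rwa [eLpNorm_exponent_top])
  · refine ⟨1, fun x => ‖g x‖ ^ p.toReal, zero_le_one, fun x => by positivity,
      hg.integrable_norm_rpow (by positivity) htop, Filter.Eventually.of_forall fun x => ?_⟩
    have hp1 : 1 ≤ p.toReal := by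
      rw [← ENNReal.toReal_one]; exact ENNReal.toReal_mono htop hp
    rcases le_total ‖g x‖ 1 with h | h
    · have : 0 ≤ ‖g x‖ ^ p.toReal := by positivity
      linarith
    · have := Real.self_le_rpow_of_one_le h hp1
      linarith

theorem MemLpAddLp.gaussDom {n : ℕ} {k a : ℝ} {f : ℝ → ℂ} {p q : ℝ≥0∞} (hp : 1 ≤ p) (hq : 1 ≤ q)
    (hfm : AEStronglyMeasurable f volume)
    (h : MemLpAddLp (fun x => (Real.exp (n * a * |x| ^ (2 / (n : ℝ))) : ℂ) * f x) p q (mu n k)) :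
    GaussDom n k a f := by
  obtain ⟨g₁, g₂, h₁, h₂, hsum⟩ := h
  obtain ⟨M₁, G₁, hM₁, hG₁, hi₁, hle₁⟩ := h₁.exists_norm_le hp
  obtain ⟨M₂, G₂, hM₂, hG₂, hi₂, hle₂⟩ := h₂.exists_norm_le hq
  refine ⟨hfm.mono_ac (mu_absolutelyContinuous n k), M₁ + M₂, fun x => G₁ x + G₂ x,
    add_nonneg hM₁ hM₂, fun x => add_nonneg (hG₁ x) (hG₂ x), hi₁.add hi₂, ?_⟩
  filter_upwards [hsum, hle₁, hle₂] with x hx h3 h4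
  rw [rad_sq] at hx
  have h5 : ‖(Real.exp (n * a * rad n x ^ 2) : ℂ) * f x‖ ≤ M₁ + M₂ + (G₁ x + G₂ x) := by
    rw [hx]
    exact (norm_add_le _ _).trans (by linarith)
  rw [norm_mul, Complex.norm_real, Real.norm_of_nonneg (Real.exp_pos _).le] at h5
  rw [Real.exp_neg, ← div_eq_inv_mul, le_div_iff₀' (Real.exp_pos _)]
  exact h5

/-! ### Hankel transforms as even entire functions -/

theorem differentiable_of_hasSum_even {c : ℕ → ℂ} {h : ℂ → ℂ}
    (hs : ∀ z, HasSum (fun m => c m * z ^ (2 * m)) (h z)) : Differentiable ℂ h := by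
  intro z
  set R : ℝ := ‖z‖ + 1 with hR
  have hR0 : 0 < R := by positivity
  have hsum : Summable fun m => ‖c m * (R : ℂ) ^ (2 * m)‖ := (hs R).summable.norm
  have hd := Complex.differentiableOn_tsum_of_summable_norm (U := Metric.ball (0 : ℂ) R)
    (F := fun m z => c m * z ^ (2 * m)) hsum (fun m => by fun_prop) Metric.isOpen_ball (by
      intro m w hw
      rw [norm_mul, norm_mul, norm_pow, norm_pow, Complex.norm_real, Real.norm_of_nonneg hR0.le]
      have := (mem_ball_zero_iff.1 hw).le
      gcongr)
  have heq : (fun w => ∑' m, c m * w ^ (2 * m)) = h := funext fun w => (hs w).tsum_eq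
  rw [heq] at hd
  exact hd.differentiableAt (Metric.isOpen_ball.mem_nhds (by simp [hR]))

/-- Every complex number is a square, so the power series in `w = z²` vanishes identically and its
coefficients are unique. -/
theorem eq_zero_of_hasSum_even {c : ℕ → ℂ}
    (hs : ∀ z : ℂ, HasSum (fun m => c m * z ^ (2 * m)) 0) : ∀ m, c m = 0 := by
  have hp : HasFPowerSeriesAt (0 : ℂ → ℂ) (FormalMultilinearSeries.ofScalars ℂ c) 0 := by
    rw [hasFPowerSeriesAt_iff]
    refine Filter.Eventually.of_forall fun w => ?_
    obtain ⟨z, rfl⟩ : ∃ z : ℂ, z ^ 2 = w := IsAlgClosed.exists_pow_nat_eq w two_pos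
    have h := hs z
    have e : (fun m => c m * z ^ (2 * m)) = fun m => (z ^ 2) ^ m * c m := by
      ext m; rw [pow_mul, mul_comm]
    rw [e] at h
    simpa only [FormalMultilinearSeries.coeff_ofScalars, Pi.zero_apply, smul_eq_mul] using h
  intro m
  have h0 : (FormalMultilinearSeries.ofScalars ℂ c).coeff m = 0 := by rw [hp.eq_zero]; rfl
  rwa [FormalMultilinearSeries.coeff_ofScalars] at h0

/-- The Hankel type transform of index `α`, as a function of a complex variable. -/
noncomputable def hankel (n : ℕ) (k α : ℝ) (f : ℝ → ℂ) (z : ℂ) : ℂ :=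
  ∫ x, f x * besselj α (n * z * rad n x) ∂(mu n k)

theorem continuous_besselj {α : ℝ} (hα : -(1 / 2) ≤ α) : Continuous (besselj α) :=
  (differentiable_of_hasSum_even (hasSum_besselj hα)).continuous

/-- Integrability against all exponentials of the radial variable. -/
def ExpIntegrable (n : ℕ) (k : ℝ) (f : ℝ → ℂ) : Prop :=
  AEStronglyMeasurable f (mu n k) ∧
    ∀ v : ℝ, 0 ≤ v → Integrable (fun x => ‖f x‖ * Real.exp (n * v * rad n x)) (mu n k)

theorem ExpIntegrable.integrable_mul {n : ℕ} {k : ℝ} {f : ℝ → ℂ} (hf : ExpIntegrable n k f)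
    {φ : ℝ → ℂ} (hφ : Continuous φ) {v : ℝ} (hv : 0 ≤ v)
    (hle : ∀ x, ‖φ x‖ ≤ Real.exp (n * v * rad n x)) :
    Integrable (fun x => f x * φ x) (mu n k) := by
  refine (hf.2 v hv).mono' (hf.1.mul hφ.aestronglyMeasurable)
    (Filter.Eventually.of_forall fun x => ?_)
  rw [norm_mul]
  gcongr
  exact hle x

theorem ExpIntegrable.integrable_hankel {n : ℕ} {k α : ℝ} (hα : -(1 / 2) ≤ α) {f : ℝ → ℂ}
    (hf : ExpIntegrable n k f) (z : ℂ) :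
    Integrable (fun x => f x * besselj α (n * z * rad n x)) (mu n k) := by
  have h1 := continuous_besselj hα
  have h2 := continuous_rad n
  refine hf.integrable_mul (by fun_prop) (abs_nonneg z.im) fun x => ?_
  refine (norm_besselj_le hα _).trans_eq ?_
  rw [Complex.im_mul_ofReal, ← Complex.ofReal_natCast, Complex.im_ofReal_mul, abs_mul, abs_mul,
    Nat.abs_cast, abs_of_nonneg (rad_nonneg n x)]

theorem norm_hankel_le {n : ℕ} {k α : ℝ} (hα : -(1 / 2) ≤ α) {f : ℝ → ℂ}
    (hf : ExpIntegrable n k f) (z : ℂ) :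
    ‖hankel n k α f z‖ ≤ ∫ x, ‖f x‖ * Real.exp (n * |z.im| * rad n x) ∂(mu n k) := by
  refine norm_integral_le_of_norm_le (hf.2 _ (abs_nonneg _))
    (Filter.Eventually.of_forall fun x => ?_)
  rw [norm_mul]
  gcongr
  refine (norm_besselj_le hα _).trans_eq ?_
  rw [Complex.im_mul_ofReal, ← Complex.ofReal_natCast, Complex.im_ofReal_mul, abs_mul, abs_mul,
    Nat.abs_cast, abs_of_nonneg (rad_nonneg n x)]

/-- Termwise integration, dominated by `‖f‖ cosh(n‖z‖ s)`. The expansion yields holomorphy and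
evenness, and exhibits the even moments of `f` as Taylor coefficients up to nonzero factors. -/
theorem hasSum_hankel {n : ℕ} {k α : ℝ} (hα : -(1 / 2) ≤ α) {f : ℝ → ℂ}
    (hf : ExpIntegrable n k f) (z : ℂ) :
    HasSum (fun m => (besselCoeff α m * (n : ℂ) ^ (2 * m) *
      ∫ x, f x * (rad n x : ℂ) ^ (2 * m) ∂(mu n k)) * z ^ (2 * m)) (hankel n k α f z) := by
  have hrc := continuous_rad n
  have hcosh : ∀ x, HasSum (fun m : ℕ => ‖f x‖ * ((n * ‖z‖ * rad n x) ^ (2 * m)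
      / (2 * m).factorial)) (‖f x‖ * Real.cosh (n * ‖z‖ * rad n x)) :=
    fun x => (Real.hasSum_cosh _).mul_left _
  have h := hasSum_integral_of_dominated_convergence (μ := mu n k)
    (F := fun (m : ℕ) x => f x * ((besselCoeff α m : ℂ) * (n * z * rad n x) ^ (2 * m)))
    (f := fun x => f x * besselj α (n * z * rad n x))
    (fun m x => ‖f x‖ * ((n * ‖z‖ * rad n x) ^ (2 * m) / (2 * m).factorial))
    (fun m => hf.1.mul (by fun_prop : Continuous fun x =>
      (besselCoeff α m : ℂ) * (n * z * rad n x) ^ (2 * m)).aestronglyMeasurable)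
    (fun m => Filter.Eventually.of_forall fun x => by
      rw [norm_mul]
      gcongr
      refine (norm_besselCoeff_mul_le hα _ m).trans_eq ?_
      rw [norm_mul, norm_mul, Complex.norm_real, Complex.norm_natCast,
        Real.norm_of_nonneg (rad_nonneg n x)])
    (Filter.Eventually.of_forall fun x => (hcosh x).summable)
    (by
      simp_rw [fun x => (hcosh x).tsum_eq]
      refine (hf.2 ‖z‖ (norm_nonneg z)).mono' (hf.1.norm.mul
        (by fun_prop : Continuous fun x =>
          Real.cosh (n * ‖z‖ * rad n x)).aestronglyMeasurable)
        (Filter.Eventually.of_forall fun x => ?_)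
      rw [norm_mul, norm_norm, Real.norm_of_nonneg (Real.cosh_pos _).le]
      gcongr
      rw [Real.cosh_eq]
      have hnn : 0 ≤ n * ‖z‖ * rad n x := by
        have := rad_nonneg n x
        positivity
      have : Real.exp (-(n * ‖z‖ * rad n x)) ≤ Real.exp (n * ‖z‖ * rad n x) :=
        Real.exp_le_exp.2 (by linarith)
      linarith)
    (Filter.Eventually.of_forall fun x => (hasSum_besselj hα _).mul_left _)
  have e : (fun m => (besselCoeff α m * (n : ℂ) ^ (2 * m) *
      ∫ x, f x * (rad n x : ℂ) ^ (2 * m) ∂(mu n k)) * z ^ (2 * m)) = fun m : ℕ =>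
      ∫ x, f x * ((besselCoeff α m : ℂ) * (n * z * rad n x) ^ (2 * m)) ∂(mu n k) := by
    ext m
    rw [← integral_const_mul, ← integral_mul_const]
    congr 1
    ext x
    ring
  rw [e]
  exact h

theorem differentiable_hankel {n : ℕ} {k α : ℝ} (hα : -(1 / 2) ≤ α) {f : ℝ → ℂ}
    (hf : ExpIntegrable n k f) : Differentiable ℂ (hankel n k α f) :=
  differentiable_of_hasSum_even (hasSum_hankel hα hf)

theorem hankel_neg {n : ℕ} {k α : ℝ} (hα : -(1 / 2) ≤ α) {f : ℝ → ℂ}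
    (hf : ExpIntegrable n k f) (z : ℂ) : hankel n k α f (-z) = hankel n k α f z := by
  refine (hasSum_hankel hα hf (-z)).unique ?_
  simpa [pow_mul] using hasSum_hankel hα hf z

theorem GaussDom.expIntegrable_pow {n : ℕ} (hn : 0 < n) {k : ℝ}
    (hk : ((n : ℝ) - 1) / (2 * n) ≤ k) {a : ℝ} (ha : 0 < a) {f : ℝ → ℂ}
    (hf : GaussDom n k a f) (g : ℝ → ℂ) (hg : AEStronglyMeasurable g (mu n k)) (j : ℕ)
    (hle : ∀ x, ‖g x‖ ≤ ‖f x‖ * (1 + rad n x) ^ j) : ExpIntegrable n k g := by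
  obtain ⟨K, N, -, hb⟩ := hf.exists_integral_le hn hk ha j
  refine ⟨hg, fun v hv => (hb v hv).1.mono' ?_ (Filter.Eventually.of_forall fun x => ?_)⟩
  · have hrc := continuous_rad n
    exact hg.norm.mul
      (by fun_prop : Continuous fun x => Real.exp (n * v * rad n x)).aestronglyMeasurable
  · rw [norm_mul, norm_norm, Real.norm_of_nonneg (Real.exp_pos _).le]
    gcongr
    exact hle x

theorem GaussDom.expIntegrable {n : ℕ} (hn : 0 < n) {k : ℝ}
    (hk : ((n : ℝ) - 1) / (2 * n) ≤ k) {a : ℝ} (ha : 0 < a) {f : ℝ → ℂ}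
    (hf : GaussDom n k a f) : ExpIntegrable n k f :=
  hf.expIntegrable_pow hn hk ha f hf.aestronglyMeasurable 0 fun x => by simp

theorem norm_mul_self_le {n : ℕ} (hn : 0 < n) (f : ℝ → ℂ) (x : ℝ) :
    ‖(x : ℂ) * f x‖ ≤ ‖f x‖ * (1 + rad n x) ^ n := by
  have hs := rad_nonneg n x
  rw [norm_mul, Complex.norm_real, Real.norm_eq_abs, ← rad_pow hn, mul_comm]
  gcongr
  linarith

theorem GaussDom.expIntegrable_mul_self {n : ℕ} (hn : 0 < n) {k : ℝ}
    (hk : ((n : ℝ) - 1) / (2 * n) ≤ k) {a : ℝ} (ha : 0 < a) {f : ℝ → ℂ}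
    (hf : GaussDom n k a f) : ExpIntegrable n k fun x => x * f x :=
  hf.expIntegrable_pow hn hk ha _
    (Complex.continuous_ofReal.aestronglyMeasurable.mul hf.aestronglyMeasurable) n
    fun x => norm_mul_self_le hn f x

theorem exists_norm_hankel_le {n : ℕ} (hn : 0 < n) {k : ℝ}
    (hk : ((n : ℝ) - 1) / (2 * n) ≤ k) {a : ℝ} (ha : 0 < a) {f : ℝ → ℂ}
    (hf : GaussDom n k a f) {α : ℝ} (hα : -(1 / 2) ≤ α) {g : ℝ → ℂ} {j : ℕ}
    (hg : ExpIntegrable n k g) (hle : ∀ x, ‖g x‖ ≤ ‖f x‖ * (1 + rad n x) ^ j) :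
    ∃ (K : ℝ) (N : ℕ), 0 ≤ K ∧ ∀ z : ℂ,
      ‖hankel n k α g z‖ ≤ K * (1 + ‖z‖) ^ N * Real.exp (n * z.im ^ 2 / (4 * a)) := by
  obtain ⟨K, N, hK, hb⟩ := hf.exists_integral_le hn hk ha j
  refine ⟨K, N, hK, fun z => (norm_hankel_le hα hg z).trans ?_⟩
  obtain ⟨hi, hile⟩ := hb |z.im| (abs_nonneg _)
  refine (integral_mono (hg.2 _ (abs_nonneg _)) hi fun x => ?_).trans (hile.trans ?_)
  · exact mul_le_mul_of_nonneg_right (hle x) (Real.exp_pos _).le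
  · rw [sq_abs]
    have := Complex.abs_im_le_norm z
    gcongr

/-- The constant in front of the odd part of the kernel. -/
noncomputable def oddConst (n : ℕ) (k : ℝ) : ℂ :=
  (-Complex.I) ^ n * (((n / 2 : ℝ) ^ n *
    (Real.Gamma (index n k + 1) / Real.Gamma (index n k + n + 1)) : ℝ) : ℂ)

theorem oddConst_ne_zero {n : ℕ} (hn : 0 < n) {k : ℝ} (hk : ((n : ℝ) - 1) / (2 * n) ≤ k) :
    oddConst n k ≠ 0 := by
  have hn' : (0 : ℝ) < n := by exact_mod_cast hn
  have h1 := Real.Gamma_pos_of_pos (by linarith [neg_half_le_index hn hk] : 0 < index n k + 1)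
  have h2 := Real.Gamma_pos_of_pos
    (by linarith [neg_half_le_index hn hk] : 0 < index n k + n + 1)
  refine mul_ne_zero (pow_ne_zero _ (by simp)) (Complex.ofReal_ne_zero.2 ?_)
  positivity

/-- Since `|yx|^(1/n)` is the product of the two radial variables, the kernel separates; the factor
`yx` of its odd part is shared between `y` outside and `x f(x)` inside the integral. -/
theorem transform_eq {n : ℕ} (hn : 0 < n) {k : ℝ} (hk : ((n : ℝ) - 1) / (2 * n) ≤ k)
    {f : ℝ → ℂ} (h₁ : ExpIntegrable n k f) (h₂ : ExpIntegrable n k fun x => x * f x) (y : ℝ) :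
    transform n k f y = hankel n k (index n k) f (rad n y)
      + oddConst n k * (y * hankel n k (index n k + n) (fun x => x * f x) (rad n y)) := by
  have i1 := h₁.integrable_hankel (neg_half_le_index hn hk) (rad n y)
  have i2 := h₂.integrable_hankel (neg_half_le_index_add hn hk) (rad n y)
  rw [hankel, hankel, ← integral_const_mul, ← integral_const_mul,
    ← integral_add i1 ((i2.const_mul _).const_mul _), transform]
  congr 1
  ext x
  have h3 : ((n * |y * x| ^ (1 / (n : ℝ)) : ℝ) : ℂ) = n * rad n y * rad n x := by
    have := rad_mul n x y
    rw [rad] at this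
    rw [this]; push_cast; ring
  rw [kernel, h3, oddConst]
  push_cast
  ring

/-! ### Uniqueness from moments -/

theorem besselj_neg_half (z : ℂ) : besselj (-(1 / 2)) z = Complex.cos z := by
  refine (hasSum_besselj le_rfl z).unique ?_
  convert Complex.hasSum_cos z using 2 with m
  have h1 := (Real.Gamma_pos_of_pos (by norm_num : (0 : ℝ) < 1 / 2)).ne'
  have h2 := (Real.Gamma_pos_of_pos (by positivity : (0 : ℝ) < m + 1 / 2)).ne'
  have : besselMoment (-(1 / 2)) m = 1 := by
    rw [besselMoment, show -(1 / 2 : ℝ) + m + 1 = m + 1 / 2 by ring,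
      show -(1 / 2 : ℝ) + 1 = 1 / 2 by ring, div_self (mul_ne_zero h1 h2)]
  rw [besselCoeff, this]
  push_cast
  ring

/-- The signed radial variable. -/
noncomputable def signedRad (n : ℕ) (x : ℝ) : ℝ := if 0 ≤ x then rad n x else -rad n x

theorem measurable_signedRad (n : ℕ) : Measurable (signedRad n) :=
  Measurable.ite measurableSet_Ici (continuous_rad n).measurable (continuous_rad n).measurable.neg

theorem signedRad_neg {n : ℕ} (hn : 0 < n) (x : ℝ) : signedRad n (-x) = -signedRad n x := by
  have hn' : (n : ℝ) ≠ 0 := by exact_mod_cast hn.ne'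
  rcases lt_trichotomy x 0 with h | h | h
  · simp [signedRad, rad_neg, not_le.2 h, h.le]
  · simp [h, signedRad, rad, hn']
  · simp [signedRad, rad_neg, not_le.2 h, h.le]

theorem exists_measurable_leftInverse_signedRad {n : ℕ} (hn : 0 < n) :
    ∃ ρ : ℝ → ℝ, Measurable ρ ∧ ∀ x, ρ (signedRad n x) = x := by
  refine ⟨fun t => if 0 ≤ t then t ^ n else -(-t) ^ n,
    Measurable.ite measurableSet_Ici (by fun_prop) (by fun_prop), fun x => ?_⟩
  have hs := rad_nonneg n x
  rcases le_or_gt 0 x with h | h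
  · simp [signedRad, h, hs, rad_pow hn, abs_of_nonneg h]
  · have hpos : 0 < rad n x := Real.rpow_pos_of_pos (abs_pos.2 h.ne) _
    simp [signedRad, not_le.2 h, not_le.2 hpos, rad_pow hn, abs_of_neg h]

/-- The cosine part is the Hankel transform of index `-1/2`, whose Taylor coefficients are multiples
of the vanishing moments; the sine part vanishes by parity. -/
theorem integral_even_mul_exp_eq_zero {n : ℕ} (hn : 0 < n) {k : ℝ} {E : ℝ → ℂ}
    (hE : ExpIntegrable n k E) (heven : ∀ x, E (-x) = E x)
    (hmom : ∀ m : ℕ, ∫ x, E x * (rad n x : ℂ) ^ (2 * m) ∂(mu n k) = 0) (t : ℝ) :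
    ∫ x, E x * Complex.exp (t * signedRad n x * Complex.I) ∂(mu n k) = 0 := by
  have hn' : (n : ℂ) ≠ 0 := by exact_mod_cast hn.ne'
  have hE0 : Integrable E (mu n k) := by
    have := hE.2 0 le_rfl
    simp only [mul_zero, zero_mul, Real.exp_zero, mul_one] at this
    exact (integrable_norm_iff hE.1).1 this
  have hm := measurable_signedRad n
  have hbdd : ∀ g : ℝ → ℝ, Measurable g → (∀ x, |g x| ≤ 1) →
      Integrable (fun x => E x * (g x : ℂ)) (mu n k) := fun g hg hb =>
    hE0.mul_bdd (c := 1) (Complex.measurable_ofReal.comp hg).aestronglyMeasurable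
      (Filter.Eventually.of_forall fun x => by simpa using hb x)
  have hc := hbdd (fun x => Real.cos (t * signedRad n x)) (by fun_prop)
    fun x => Real.abs_cos_le_one _
  have hs := hbdd (fun x => Real.sin (t * signedRad n x)) (by fun_prop)
    fun x => Real.abs_sin_le_one _
  have hcos : ∫ x, E x * (Real.cos (t * signedRad n x) : ℂ) ∂(mu n k) = 0 := by
    have h1 : hankel n k (-(1 / 2)) E (t / n) = 0 := by
      refine (hasSum_hankel le_rfl hE _).unique ?_
      simp [hmom, hasSum_zero]
    rw [← h1, hankel]
    congr 1
    ext x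
    rw [besselj_neg_half, mul_div_cancel₀ _ hn', ← Complex.ofReal_mul, ← Complex.ofReal_cos]
    congr 2
    unfold signedRad
    split_ifs
    · rfl
    · rw [mul_neg, Real.cos_neg]
  have hsin : ∫ x, E x * (Real.sin (t * signedRad n x) : ℂ) ∂(mu n k) = 0 :=
    integral_eq_zero_of_odd n k fun x => by
      rw [heven, signedRad_neg hn, mul_neg, Real.sin_neg]; push_cast; ring
  have : (fun x => E x * Complex.exp (t * signedRad n x * Complex.I)) = fun x =>
      E x * (Real.cos (t * signedRad n x) : ℂ)
        + E x * (Real.sin (t * signedRad n x) : ℂ) * Complex.I := by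
    ext x
    rw [Complex.exp_mul_I]; push_cast; ring
  rw [this, integral_add hc (hs.mul_const _), integral_mul_const, hcos, hsin]
  simp

/-- The positive and negative parts of `E` define two finite measures whose images under `signedRad`
have the same characteristic function. The images therefore coincide, and so do the measures, as
`signedRad` has a measurable left inverse. -/
theorem ae_eq_zero_of_real_even {n : ℕ} (hn : 0 < n) {k : ℝ} {E : ℝ → ℝ}
    (hE : ExpIntegrable n k fun x => (E x : ℂ)) (heven : ∀ x, E (-x) = E x)
    (hmom : ∀ m : ℕ, ∫ x, (E x : ℂ) * (rad n x : ℂ) ^ (2 * m) ∂(mu n k) = 0) :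
    ∀ᵐ x ∂(mu n k), E x = 0 := by
  have hE0 : Integrable E (mu n k) := by
    have := hE.2 0 le_rfl
    simp only [mul_zero, zero_mul, Real.exp_zero, mul_one] at this
    exact ((integrable_norm_iff hE.1).1 this).re
  have hm := measurable_signedRad n
  set νp := (mu n k).withDensity fun x => ENNReal.ofReal (E x) with hνp
  set νm := (mu n k).withDensity fun x => ENNReal.ofReal (-E x) with hνm
  have hmp : AEMeasurable (fun x => ENNReal.ofReal (E x)) (mu n k) :=
    hE0.aestronglyMeasurable.aemeasurable.ennreal_ofReal
  have hmm : AEMeasurable (fun x => ENNReal.ofReal (-E x)) (mu n k) :=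
    hE0.aestronglyMeasurable.aemeasurable.neg.ennreal_ofReal
  have : IsFiniteMeasure νp := isFiniteMeasure_withDensity_ofReal hE0.2
  have : IsFiniteMeasure νm := isFiniteMeasure_withDensity_ofReal hE0.neg.2
  have hmap : νp.map (signedRad n) = νm.map (signedRad n) := by
    refine Measure.ext_of_charFun ?_
    ext t
    have hcm : Measurable fun x : ℝ => Complex.exp (t * x * Complex.I) := by fun_prop
    have hexp : ∀ᵐ x ∂(mu n k), ‖Complex.exp (t * signedRad n x * Complex.I)‖ ≤ 1 :=
      Filter.Eventually.of_forall fun x => by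
        rw [← Complex.ofReal_mul, Complex.norm_exp_ofReal_mul_I]
    have hpp : Integrable (fun x => (ENNReal.ofReal (E x)).toReal) (mu n k) := by
      simpa only [ENNReal.toReal_ofReal'] using hE0.pos_part
    have hpm : Integrable (fun x => (ENNReal.ofReal (-E x)).toReal) (mu n k) := by
      simpa only [ENNReal.toReal_ofReal'] using hE0.neg_part
    rw [charFun_apply_real, charFun_apply_real, integral_map hm.aemeasurable
      hcm.aestronglyMeasurable, integral_map hm.aemeasurable hcm.aestronglyMeasurable,
      hνp, hνm, integral_withDensity_eq_integral_toReal_smul₀ hmp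
        (Filter.Eventually.of_forall fun _ => ENNReal.ofReal_lt_top),
      integral_withDensity_eq_integral_toReal_smul₀ hmm
        (Filter.Eventually.of_forall fun _ => ENNReal.ofReal_lt_top), ← sub_eq_zero,
      ← integral_sub, ← integral_even_mul_exp_eq_zero hn hE (fun x => by rw [heven]) hmom t]
    · congr 1
      ext x
      rw [← sub_smul, ENNReal.toReal_ofReal', ENNReal.toReal_ofReal', Complex.real_smul,
        max_zero_sub_eq_self]
    · exact Integrable.smul_bdd (𝕜 := ℝ) hpp 1 (hcm.comp hm).aestronglyMeasurable hexp
    · exact Integrable.smul_bdd (𝕜 := ℝ) hpm 1 (hcm.comp hm).aestronglyMeasurable hexp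
  obtain ⟨ρ, hρ, hρinv⟩ := exists_measurable_leftInverse_signedRad hn
  have hν : νp = νm := by
    have h1 := congrArg (Measure.map ρ) hmap
    rw [Measure.map_map hρ hm, Measure.map_map hρ hm] at h1
    have h2 : ρ ∘ signedRad n = id := funext hρinv
    rwa [h2, Measure.map_id, Measure.map_id] at h1
  have hfin : ∫⁻ x, ENNReal.ofReal (E x) ∂(mu n k) ≠ ⊤ := by
    have := measure_ne_top νp Set.univ
    rwa [hνp, withDensity_apply _ MeasurableSet.univ, Measure.restrict_univ] at this
  have h3 := (withDensity_eq_iff hmp hmm hfin).1 hν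
  filter_upwards [h3] with x hx
  rcases lt_trichotomy (E x) 0 with h | h | h
  · rw [ENNReal.ofReal_of_nonpos h.le, eq_comm, ENNReal.ofReal_eq_zero] at hx; linarith
  · exact h
  · rw [ENNReal.ofReal_of_nonpos (by linarith : -E x ≤ 0), ENNReal.ofReal_eq_zero] at hx; linarith

theorem ExpIntegrable.integrable_moment {n : ℕ} (hn : 0 < n) {k : ℝ} {f : ℝ → ℂ}
    (hf : ExpIntegrable n k f) (m : ℕ) :
    Integrable (fun x => f x * (rad n x : ℂ) ^ m) (mu n k) := by
  have hn' : (1 : ℝ) ≤ n := by exact_mod_cast hn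
  have hrc := continuous_rad n
  refine hf.integrable_mul (by fun_prop) m.cast_nonneg fun x => ?_
  have hs := rad_nonneg n x
  rw [norm_pow, Complex.norm_real, Real.norm_of_nonneg hs]
  calc rad n x ^ m ≤ Real.exp (rad n x) ^ m := by
        gcongr
        linarith [Real.add_one_le_exp (rad n x)]
    _ = Real.exp (m * rad n x) := by rw [← Real.exp_nat_mul]
    _ ≤ _ := by
        gcongr
        exact le_mul_of_one_le_left m.cast_nonneg hn'

theorem ae_eq_zero_of_even {n : ℕ} (hn : 0 < n) {k : ℝ} {E : ℝ → ℂ}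
    (hE : ExpIntegrable n k E) (heven : ∀ x, E (-x) = E x)
    (hmom : ∀ m : ℕ, ∫ x, E x * (rad n x : ℂ) ^ (2 * m) ∂(mu n k) = 0) :
    ∀ᵐ x ∂(mu n k), E x = 0 := by
  have hpart : ∀ g : ℂ →L[ℝ] ℝ, (∀ z, |g z| ≤ ‖z‖) → ∀ᵐ x ∂(mu n k), g (E x) = 0 := by
    intro g hg
    refine ae_eq_zero_of_real_even hn (E := fun x => g (E x)) ⟨?_, fun v hv => ?_⟩
      (fun x => by rw [heven]) fun m => ?_
    · exact Complex.continuous_ofReal.comp_aestronglyMeasurable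
        (g.continuous.comp_aestronglyMeasurable hE.1)
    · have hrc := continuous_rad n
      refine (hE.2 v hv).mono' ((Complex.continuous_ofReal.comp_aestronglyMeasurable
        (g.continuous.comp_aestronglyMeasurable hE.1)).norm.mul
        (by fun_prop : Continuous fun x => Real.exp (n * v * rad n x)).aestronglyMeasurable)
        (Filter.Eventually.of_forall fun x => ?_)
      rw [norm_mul, norm_norm, Real.norm_of_nonneg (Real.exp_pos _).le, Complex.norm_real]
      gcongr
      exact hg _
    · have h1 := g.integral_comp_comm (hE.integrable_moment hn (2 * m))
      rw [hmom, map_zero] at h1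
      have h2 : ∀ x, (g (E x) : ℂ) * (rad n x : ℂ) ^ (2 * m)
          = ((g (E x * (rad n x : ℂ) ^ (2 * m)) : ℝ) : ℂ) := by
        intro x
        have : E x * (rad n x : ℂ) ^ (2 * m) = (rad n x ^ (2 * m)) • E x := by
          rw [Complex.real_smul]; push_cast; ring
        rw [this, map_smul, smul_eq_mul]
        push_cast; ring
      simp_rw [h2]
      rw [integral_complex_ofReal, h1, Complex.ofReal_zero]
  filter_upwards [hpart Complex.reCLM Complex.abs_re_le_norm,
    hpart Complex.imCLM Complex.abs_im_le_norm] with x h1 h2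
  exact Complex.ext h1 h2

theorem ExpIntegrable.comp_neg {n : ℕ} {k : ℝ} {f : ℝ → ℂ} (hf : ExpIntegrable n k f) :
    ExpIntegrable n k fun x => f (-x) := by
  have hmp : MeasurePreserving (fun x : ℝ => -x) (mu n k) (mu n k) :=
    ⟨measurable_neg, map_neg_mu n k⟩
  refine ⟨hf.1.comp_measurePreserving hmp, fun v hv => ?_⟩
  have := hmp.integrable_comp_of_integrable (hf.2 v hv)
  simpa only [Function.comp_def, rad_neg] using this

theorem ExpIntegrable.add {n : ℕ} {k : ℝ} {f g : ℝ → ℂ} (hf : ExpIntegrable n k f)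
    (hg : ExpIntegrable n k g) : ExpIntegrable n k fun x => f x + g x := by
  have hrc := continuous_rad n
  refine ⟨hf.1.add hg.1, fun v hv => ((hf.2 v hv).add (hg.2 v hv)).mono' ((hf.1.add hg.1).norm.mul
    (by fun_prop : Continuous fun x => Real.exp (n * v * rad n x)).aestronglyMeasurable)
    (Filter.Eventually.of_forall fun x => ?_)⟩
  rw [norm_mul, norm_norm, Real.norm_of_nonneg (Real.exp_pos _).le, Pi.add_apply, ← add_mul]
  gcongr
  exact norm_add_le _ _

theorem ExpIntegrable.const_mul {n : ℕ} {k : ℝ} {f : ℝ → ℂ} (hf : ExpIntegrable n k f) (c : ℂ) :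
    ExpIntegrable n k fun x => c * f x := by
  refine ⟨hf.1.const_mul c, fun v hv => ((hf.2 v hv).const_mul ‖c‖).congr
    (Filter.Eventually.of_forall fun x => ?_)⟩
  simp only [norm_mul]
  ring

/-- A function with exponential decay is determined by its even and odd moments. -/
theorem ae_eq_zero_of_moments {n : ℕ} (hn : 0 < n) {k : ℝ} {D : ℝ → ℂ}
    (h₁ : ExpIntegrable n k D) (h₂ : ExpIntegrable n k fun x => x * D x)
    (hev : ∀ m : ℕ, ∫ x, D x * (rad n x : ℂ) ^ (2 * m) ∂(mu n k) = 0)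
    (hodd : ∀ m : ℕ, ∫ x, x * D x * (rad n x : ℂ) ^ (2 * m) ∂(mu n k) = 0) :
    ∀ᵐ x ∂(mu n k), D x = 0 := by
  -- Symmetrization gives `D(x) + D(-x) = 0` and, from `x D(x)`, `x D(x) - x D(-x) = 0`; together
  -- `2x D(x) = 0`.
  have hsym : ∀ g : ℝ → ℂ, ExpIntegrable n k g →
      (∀ m : ℕ, ∫ x, g x * (rad n x : ℂ) ^ (2 * m) ∂(mu n k) = 0) →
      ∀ᵐ x ∂(mu n k), g x + g (-x) = 0 := by
    intro g hg hmom
    refine ae_eq_zero_of_even hn (hg.add hg.comp_neg)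
      (fun x => by rw [neg_neg, add_comm]) fun m => ?_
    have h3 := integral_neg_mu n k fun x => g x * (rad n x : ℂ) ^ (2 * m)
    simp only [rad_neg] at h3
    simp_rw [add_mul]
    rw [integral_add (hg.integrable_moment hn _) (hg.comp_neg.integrable_moment hn _), h3, hmom,
      add_zero]
  filter_upwards [hsym _ h₁ hev, hsym _ h₂ hodd, ae_mu_ne_zero n k] with x a1 a2 a3
  push_cast at a2
  have a4 : (x : ℂ) * (2 * D x) = 0 := by linear_combination a2 + x * a1
  rcases mul_eq_zero.1 a4 with h | h
  · exact absurd (Complex.ofReal_eq_zero.1 h) a3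
  · exact (mul_eq_zero.1 h).resolve_left two_ne_zero

/-! ### The Gaussian and its transform -/

/-- The Gaussian `e^(-n a |x|^(2/n))`. -/
noncomputable def gauss (n : ℕ) (a x : ℝ) : ℂ := (Real.exp (-(n * a * rad n x ^ 2)) : ℝ)

theorem continuous_gauss (n : ℕ) (a : ℝ) : Continuous (gauss n a) := by
  have := continuous_rad n
  unfold gauss
  fun_prop

theorem gauss_neg (n : ℕ) (a x : ℝ) : gauss n a (-x) = gauss n a x := by
  simp [gauss, rad_neg]

theorem norm_gauss (n : ℕ) (a x : ℝ) : ‖gauss n a x‖ = Real.exp (-(n * a * rad n x ^ 2)) := by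
  rw [gauss, Complex.norm_real, Real.norm_of_nonneg (Real.exp_pos _).le]

theorem gaussDom_gauss (n : ℕ) (k a : ℝ) : GaussDom n k a (gauss n a) :=
  ⟨(continuous_gauss n a).aestronglyMeasurable, 1, 0, zero_le_one, fun _ => le_rfl,
    integrable_zero _ _ _, Filter.Eventually.of_forall fun x => by simp [norm_gauss]⟩

theorem moment_gauss {n : ℕ} (hn : 0 < n) {k : ℝ} (hk : ((n : ℝ) - 1) / (2 * n) ≤ k) {a : ℝ}
    (ha : 0 < a) (m : ℕ) :
    ∫ x, gauss n a x * (rad n x : ℂ) ^ (2 * m) ∂(mu n k) =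
      ((radConst n k * ((n * a) ^ (-(index n k + m + 1)) * (1 / 2)
        * Real.Gamma (index n k + m + 1)) : ℝ) : ℂ) := by
  have hn' : (0 : ℝ) < n := by exact_mod_cast hn
  have hα := neg_half_le_index hn hk
  have h1 : ∀ x, gauss n a x * (rad n x : ℂ) ^ (2 * m)
      = ((Real.exp (-(n * a * rad n x ^ 2)) * rad n x ^ (2 * m) : ℝ) : ℂ) := by
    intro x; rw [gauss]; push_cast; ring
  simp_rw [h1]
  rw [integral_complex_ofReal, integral_rad hn hk
    (φ := fun s => Real.exp (-(n * a * s ^ 2)) * s ^ (2 * m)) (by fun_prop)]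
  congr 1
  have hm : (0 : ℝ) ≤ m := m.cast_nonneg
  have h2 := integral_rpow_mul_exp_neg_mul_rpow (p := 2) (q := 2 * index n k + 1 + 2 * m)
    (b := n * a) two_pos (by linarith) (by positivity)
  rw [show -(2 * index n k + 1 + 2 * m + 1) / 2 = -(index n k + m + 1) by ring,
    show (2 * index n k + 1 + 2 * m + 1) / 2 = index n k + m + 1 by ring] at h2
  rw [← h2, ← integral_const_mul]
  refine setIntegral_congr_fun measurableSet_Ioi fun s hs => ?_
  have hs' : (0 : ℝ) < s := hs
  rw [Real.rpow_add hs' (2 * index n k + 1) (2 * (m : ℝ)), show (2 : ℝ) * m = ((2 * m : ℕ) : ℝ) by push_cast; ring,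
    Real.rpow_natCast, Real.rpow_two, neg_mul]
  ring

/-- The factor `Γ(α + m + 1)` of the moment cancels the one in the Bessel coefficient, which leaves
the exponential series. -/
theorem hankel_gauss {n : ℕ} (hn : 0 < n) {k : ℝ} (hk : ((n : ℝ) - 1) / (2 * n) ≤ k) {a : ℝ}
    (ha : 0 < a) (z : ℂ) :
    hankel n k (index n k) (gauss n a) z =
      (((2 * a) ^ (-(index n k + 1)) : ℝ) : ℂ) * Complex.exp (-(n * z ^ 2 / (4 * a))) := by
  have hn' : (0 : ℝ) < n := by exact_mod_cast hn
  have hα := neg_half_le_index hn hk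
  have hs := hasSum_hankel hα ((gaussDom_gauss n k a).expIntegrable hn hk ha) z
  refine hs.unique ?_
  rw [Complex.exp_eq_exp_ℂ]
  have h1 := (NormedSpace.expSeries_div_hasSum_exp (-(n * z ^ 2 / (4 * a)) : ℂ)).mul_left
    (((2 * a) ^ (-(index n k + 1)) : ℝ) : ℂ)
  have e : (fun m : ℕ => (besselCoeff (index n k) m * (n : ℂ) ^ (2 * m) *
      ∫ x, gauss n a x * (rad n x : ℂ) ^ (2 * m) ∂(mu n k)) * z ^ (2 * m)) = fun m : ℕ =>
      (((2 * a) ^ (-(index n k + 1)) : ℝ) : ℂ) *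
        ((-(n * z ^ 2 / (4 * a))) ^ m / (m.factorial : ℂ)) := by
    ext m
    rw [moment_gauss hn hk ha]
    have hm : (0 : ℝ) ≤ m := m.cast_nonneg
    have hreal : besselCoeff (index n k) m * (n : ℝ) ^ (2 * m) * (radConst n k *
        ((n * a) ^ (-(index n k + m + 1)) * (1 / 2) * Real.Gamma (index n k + m + 1)))
        = (2 * a) ^ (-(index n k + 1)) * ((-(n / (4 * a))) ^ m / m.factorial) := by
      have g1 := (Real.Gamma_pos_of_pos (by linarith : 0 < index n k + 1)).ne'
      have g2 := (Real.Gamma_pos_of_pos (by linarith : 0 < index n k + m + 1)).ne'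
      have e1 : (n * a : ℝ) ^ (-(index n k + m + 1))
          = (n * a) ^ (-(index n k + 1)) * ((n * a) ^ m)⁻¹ := by
        rw [show -(index n k + m + 1) = -(index n k + 1) + -(m : ℝ) by ring,
          Real.rpow_add (by positivity), Real.rpow_neg (by positivity) (m : ℝ),
          Real.rpow_natCast]
      have e2 : (n * a : ℝ) ^ (-(index n k + 1))
          = ((n / 2 : ℝ) ^ index n k * (n / 2))⁻¹ * (2 * a) ^ (-(index n k + 1)) := by
        rw [show (n * a : ℝ) = n / 2 * (2 * a) by ring,
          Real.mul_rpow (by positivity) (by positivity),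
          Real.rpow_neg (by positivity : (0 : ℝ) ≤ n / 2),
          Real.rpow_add_one (by positivity : (n / 2 : ℝ) ≠ 0)]
      have e3 : (-(n / (4 * a)) : ℝ) ^ m = (-1) ^ m * n ^ m / (4 ^ m * a ^ m) := by
        rw [neg_pow, div_pow, mul_pow]; ring
      have e4 : (n : ℝ) ^ (2 * m) = n ^ m * n ^ m := by rw [two_mul, pow_add]
      have e5 : (0 : ℝ) < (n / 2 : ℝ) ^ index n k := by positivity
      rw [besselCoeff_eq, radConst, e1, e2, e3, e4, mul_pow]
      generalize (n / 2 : ℝ) ^ index n k = P at e5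
      generalize (2 * a) ^ (-(index n k + 1)) = Q
      generalize Real.Gamma (index n k + 1) = G at g1 ⊢
      generalize Real.Gamma (index n k + m + 1) = G' at g2 ⊢
      field_simp
    have hc := congrArg (fun r : ℝ => (r : ℂ)) hreal
    push_cast at hc ⊢
    rw [hc, pow_mul]
    have e6 : (-((n : ℂ) * z ^ 2 / (4 * a))) ^ m = (-(n / (4 * a))) ^ m * (z ^ 2) ^ m := by
      rw [← mul_pow]; congr 1; ring
    rw [e6]
    ring
  rw [e]
  exact h1

theorem hankel_odd_gauss (n : ℕ) (k α a : ℝ) (z : ℂ) :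
    hankel n k α (fun x => x * gauss n a x) z = 0 :=
  integral_eq_zero_of_odd n k fun x => by
    simp only [gauss_neg, rad_neg]; push_cast; ring

theorem transform_gauss {n : ℕ} (hn : 0 < n) {k : ℝ} (hk : ((n : ℝ) - 1) / (2 * n) ≤ k) {a : ℝ}
    (ha : 0 < a) (y : ℝ) :
    transform n k (gauss n a) y =
      (((2 * a) ^ (-(index n k + 1)) * Real.exp (-(n * rad n y ^ 2 / (4 * a))) : ℝ) : ℂ) := by
  have hg := gaussDom_gauss n k a
  rw [transform_eq hn hk (hg.expIntegrable hn hk ha) (hg.expIntegrable_mul_self hn hk ha),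
    hankel_odd_gauss, hankel_gauss hn hk ha]
  push_cast
  ring

theorem moment_eq_zero_of_hankel_eq_zero {n : ℕ} (hn : 0 < n) {k α : ℝ} (hα : -(1 / 2) ≤ α)
    {g : ℝ → ℂ} (hg : ExpIntegrable n k g) (h0 : ∀ z, hankel n k α g z = 0) (m : ℕ) :
    ∫ x, g x * (rad n x : ℂ) ^ (2 * m) ∂(mu n k) = 0 := by
  have hn' : (n : ℂ) ≠ 0 := by exact_mod_cast hn.ne'
  have h := eq_zero_of_hasSum_even (fun z => by
    have := hasSum_hankel hα hg z
    rwa [h0] at this) m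
  refine (mul_eq_zero.1 h).resolve_left (mul_ne_zero ?_ (pow_ne_zero _ hn'))
  exact_mod_cast besselCoeff_ne_zero hα m

theorem hankel_add_const_mul {n : ℕ} {k α : ℝ} (hα : -(1 / 2) ≤ α) {f g : ℝ → ℂ}
    (hf : ExpIntegrable n k f) (hg : ExpIntegrable n k g) (c z : ℂ) :
    hankel n k α (fun x => f x + c * g x) z = hankel n k α f z + c * hankel n k α g z := by
  rw [hankel, hankel, hankel, ← integral_const_mul,
    ← integral_add (hf.integrable_hankel hα z) ((hg.integrable_hankel hα z).const_mul c)]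
  congr 1
  ext x
  ring

/-- The difference `f - l · gauss` has vanishing even and odd Hankel transforms. The Bessel
coefficients are nonzero, so all its moments vanish. -/
theorem eq_const_mul_gauss_of_hankel {n : ℕ} (hn : 0 < n) {k : ℝ}
    (hk : ((n : ℝ) - 1) / (2 * n) ≤ k) {a : ℝ} (ha : 0 < a) {f : ℝ → ℂ}
    (h₁ : ExpIntegrable n k f) (h₂ : ExpIntegrable n k fun x => x * f x) {l : ℂ}
    (he : ∀ z, hankel n k (index n k) f z = l * hankel n k (index n k) (gauss n a) z)
    (ho : ∀ z, hankel n k (index n k + n) (fun x => x * f x) z = 0) :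
    ∀ᵐ x ∂(mu n k), f x = l * gauss n a x := by
  have hα := neg_half_le_index hn hk
  have hα' := neg_half_le_index_add hn hk
  have g₁ := (gaussDom_gauss n k a).expIntegrable hn hk ha
  have g₂ := (gaussDom_gauss n k a).expIntegrable_mul_self hn hk ha
  have hx : (fun x : ℝ => (x : ℂ) * (f x + -l * gauss n a x))
      = fun x => x * f x + -l * (x * gauss n a x) := by ext x; ring
  have hD₁ := h₁.add (g₁.const_mul (-l))
  have hD₂ : ExpIntegrable n k fun x : ℝ => (x : ℂ) * (f x + -l * gauss n a x) := by
    rw [hx]; exact h₂.add (g₂.const_mul (-l))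
  have h := ae_eq_zero_of_moments hn hD₁ hD₂
    (moment_eq_zero_of_hankel_eq_zero hn hα hD₁ fun z => by
      rw [hankel_add_const_mul hα h₁ g₁, he]; ring)
    (moment_eq_zero_of_hankel_eq_zero hn hα' hD₂ fun z => by
      rw [hx, hankel_add_const_mul hα' h₂ g₂, ho, hankel_odd_gauss]; ring)
  filter_upwards [h] with x hx
  linear_combination hx

/-! ### The critical case `ab = 1/4` -/

theorem posLog_le_of_le {r K w t : ℝ} {N : ℕ} (hr : 0 ≤ r) (hK : 0 ≤ K) (ht : 0 ≤ t) (hw : 0 ≤ w)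
    (h : w ≤ K * (1 + r) ^ N * Real.exp t) :
    Real.posLog w ≤ Real.log (1 + K) + N * Real.log (1 + r) + t := by
  have h1 : 0 ≤ Real.log (1 + K) := Real.log_nonneg (by linarith)
  have h2 : 0 ≤ Real.log (1 + r) := Real.log_nonneg (by linarith)
  rw [Real.posLog_apply]
  refine max_le (by positivity) ?_
  rcases hw.eq_or_lt with h0 | h0
  · rw [← h0, Real.log_zero]; positivity
  · calc Real.log w ≤ Real.log ((1 + K) * (1 + r) ^ N * Real.exp t) := by
          refine Real.log_le_log h0 (h.trans ?_)
          gcongr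
          linarith
      _ = _ := by
          rw [Real.log_mul (by positivity) (Real.exp_pos t).ne', Real.log_exp,
            Real.log_mul (by positivity) (by positivity), Real.log_pow]

theorem lintegral_lt_top_of_halves {g : ℝ → ℝ≥0∞} (h₁ : ∫⁻ x in Set.Ioi 0, g x < ⊤)
    (h₂ : ∫⁻ x in Set.Ioi 0, g (-x) < ⊤) : ∫⁻ x, g x < ⊤ := by
  rw [← lintegral_add_compl _ (measurableSet_Ioi (a := (0 : ℝ))), Set.compl_Ioi]
  refine ENNReal.add_lt_top.2 ⟨h₁, ?_⟩
  rw [setLIntegral_congr Iio_ae_eq_Iic.symm]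
  have := (Measure.measurePreserving_neg (volume : Measure ℝ)).setLIntegral_comp_preimage_emb
    (MeasurableEquiv.neg ℝ).measurableEmbedding g (Set.Iio 0)
  rw [← this]
  simpa using h₂

/-- The entire functions whose restrictions to the half line are the two halves of
`e^(n b |y|^(2/n)) F f(y) / C`. -/
noncomputable def halfTransform (n : ℕ) (k b C : ℝ) (f : ℝ → ℂ) (σ z : ℂ) : ℂ :=
  Complex.exp (n * b * z ^ 2) * (hankel n k (index n k) f z
    + σ * (oddConst n k * (z ^ n * hankel n k (index n k + n) (fun x => x * f x) z))) / C

/-- Here `ab = 1/4` is used: `|e^(nb z²)| = e^(nb (Re z)² - nb (Im z)²)`, and `n (Im z)²/(4a) = nb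
(Im z)²`, so only the real part survives in the exponent. -/
theorem growthBound_halfTransform {n : ℕ} (hn : 0 < n) {k : ℝ}
    (hk : ((n : ℝ) - 1) / (2 * n) ≤ k) {a b C : ℝ} (ha : 0 < a) (hb : 0 < b) (hab : a * b = 1 / 4)
    (hC : 0 < C) {f : ℝ → ℂ} (hf : GaussDom n k a f) {σ : ℂ} (hσ : ‖σ‖ ≤ 1) :
    ∃ A N : ℝ, GrowthBound (halfTransform n k b C f σ) A N (n * b) := by
  have hα := neg_half_le_index hn hk
  have hα' := neg_half_le_index_add hn hk
  have h₁ := hf.expIntegrable hn hk ha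
  have h₂ := hf.expIntegrable_mul_self hn hk ha
  obtain ⟨K₁, N₁, hK₁, hle₁⟩ := exists_norm_hankel_le hn hk ha hf hα (j := 0) h₁ (by simp)
  obtain ⟨K₂, N₂, hK₂, hle₂⟩ := exists_norm_hankel_le hn hk ha hf hα' h₂ (norm_mul_self_le hn f)
  set K := (K₁ + ‖oddConst n k‖ * K₂) / C with hK
  have hK0 : 0 ≤ K := by positivity
  refine ⟨Real.log (1 + K), (n + N₁ + N₂ : ℕ), ?_, ⟨Real.log_nonneg (by linarith),
    Nat.cast_nonneg _, by positivity⟩, fun z => ?_⟩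
  · have d₁ := differentiable_hankel hα h₁
    have d₂ := differentiable_hankel hα' h₂
    unfold halfTransform
    fun_prop
  · refine posLog_le_of_le (norm_nonneg z) hK0 (by positivity) (norm_nonneg _) ?_
    have hz : 1 ≤ 1 + ‖z‖ := by linarith [norm_nonneg z]
    set Y := Real.exp (n * z.im ^ 2 / (4 * a)) with hY
    have hY0 : 0 < Y := Real.exp_pos _
    have hexp : ‖Complex.exp (n * b * z ^ 2)‖ * Y = Real.exp (n * b * z.re ^ 2) := by
      have h4 : n * z.im ^ 2 / (4 * a) = n * b * z.im ^ 2 := by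
        rw [div_eq_iff (by positivity)]
        linear_combination (-4 * n * z.im ^ 2) * hab
      have h5 : ((n : ℂ) * b * z ^ 2).re = n * b * (z.re ^ 2 - z.im ^ 2) := by
        rw [← Complex.ofReal_natCast, ← Complex.ofReal_mul, Complex.re_ofReal_mul, sq z,
          Complex.mul_re]
        ring
      rw [Complex.norm_exp, hY, h4, h5, ← Real.exp_add]
      ring_nf
    have hsum : ‖hankel n k (index n k) f z + σ * (oddConst n k *
        (z ^ n * hankel n k (index n k + n) (fun x => x * f x) z))‖
        ≤ (K₁ + ‖oddConst n k‖ * K₂) * (1 + ‖z‖) ^ (n + N₁ + N₂) * Y := by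
      have b₁ : ‖hankel n k (index n k) f z‖ ≤ K₁ * (1 + ‖z‖) ^ (n + N₁ + N₂) * Y := by
        refine (hle₁ z).trans ?_
        gcongr ?_ * (1 + ‖z‖) ^ ?_ * Y
        omega
      have b₂ : ‖σ * (oddConst n k *
          (z ^ n * hankel n k (index n k + n) (fun x => x * f x) z))‖
          ≤ ‖oddConst n k‖ * K₂ * (1 + ‖z‖) ^ (n + N₁ + N₂) * Y := by
        rw [norm_mul, norm_mul, norm_mul, norm_pow]
        calc ‖σ‖ * (‖oddConst n k‖ * (‖z‖ ^ n *
              ‖hankel n k (index n k + n) (fun x => x * f x) z‖))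
            ≤ 1 * (‖oddConst n k‖ * ((1 + ‖z‖) ^ n * (K₂ * (1 + ‖z‖) ^ N₂ * Y))) := by
              gcongr
              · linarith
              · exact hle₂ z
          _ = ‖oddConst n k‖ * K₂ * (1 + ‖z‖) ^ (n + N₂) * Y := by rw [pow_add]; ring
          _ ≤ _ := by
              gcongr ?_ * (1 + ‖z‖) ^ ?_ * Y
              omega
      refine (norm_add_le _ _).trans ((add_le_add b₁ b₂).trans_eq ?_)
      ring
    rw [halfTransform, norm_div, norm_mul, Complex.norm_real, Real.norm_of_nonneg hC.le,
      div_le_iff₀ hC]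
    calc _ ≤ ‖Complex.exp (n * b * z ^ 2)‖ *
          ((K₁ + ‖oddConst n k‖ * K₂) * (1 + ‖z‖) ^ (n + N₁ + N₂) * Y) := by gcongr
      _ = (K₁ + ‖oddConst n k‖ * K₂) * (1 + ‖z‖) ^ (n + N₁ + N₂) *
          (‖Complex.exp (n * b * z ^ 2)‖ * Y) := by ring
      _ = _ := by rw [hexp, hK]; field_simp

/-- Both Hankel transforms are even, so reflection acts only on `z^n`. It maps `σ = ±1` to a sign
again, so the two half-line estimates cover the whole real line. -/
theorem halfTransform_neg {n : ℕ} (hn : 0 < n) {k : ℝ}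
    (hk : ((n : ℝ) - 1) / (2 * n) ≤ k) (b C : ℝ) {f : ℝ → ℂ} (h₁ : ExpIntegrable n k f)
    (h₂ : ExpIntegrable n k fun x => x * f x) (σ z : ℂ) :
    halfTransform n k b C f σ (-z) = halfTransform n k b C f (σ * (-1) ^ n) z := by
  rw [halfTransform, halfTransform, hankel_neg (neg_half_le_index hn hk) h₁,
    hankel_neg (neg_half_le_index_add hn hk) h₂, neg_pow z n, neg_sq]
  ring

theorem exp_mul_transform_eq {n : ℕ} (hn : 0 < n) {k : ℝ}
    (hk : ((n : ℝ) - 1) / (2 * n) ≤ k) (b C : ℝ) {f : ℝ → ℂ} (h₁ : ExpIntegrable n k f)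
    (h₂ : ExpIntegrable n k fun x => x * f x) {x σ : ℝ} (hx : x = σ * |x|) :
    (Real.exp (n * b * |x| ^ (2 / (n : ℝ))) : ℂ) * transform n k f x / (C : ℂ)
      = halfTransform n k b C f σ (rad n x) := by
  rw [transform_eq hn hk h₁ h₂, halfTransform, rad_sq]
  have : (x : ℂ) = σ * (rad n x : ℂ) ^ n := by
    rw [← Complex.ofReal_pow, rad_pow hn, ← Complex.ofReal_mul, ← hx]
  conv_lhs => rw [this]
  push_cast
  ring

theorem lintegral_Ioi_lt_top_of_mu {n : ℕ} (hn : 0 < n) {k : ℝ}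
    (hk : ((n : ℝ) - 1) / (2 * n) ≤ k) {φ : ℝ → ℝ} (hφ : Continuous φ)
    (h : ∫⁻ x in Set.Ioi 0, ENNReal.ofReal (φ (rad n x)) ∂(mu n k) < ⊤) :
    ∫⁻ s in Set.Ioi 0, ENNReal.ofReal (φ s) < ⊤ := by
  have hα := neg_half_le_index hn hk
  rw [lintegral_Ioi_mu hn hk (g := fun s => ENNReal.ofReal (φ s))
    hφ.measurable.ennreal_ofReal] at h
  exact lintegral_Ioi_lt_top_of_weight (half_pos (radConst_pos hn hk)) (by linarith) hφ h

theorem lintegral_halfTransform_lt_top {n : ℕ} (hn : 0 < n) {k : ℝ}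
    (hk : ((n : ℝ) - 1) / (2 * n) ≤ k) {b C : ℝ} {f : ℝ → ℂ} (h₁ : ExpIntegrable n k f)
    (h₂ : ExpIntegrable n k fun x => x * f x)
    (hint : ∫⁻ x, ENNReal.ofReal (Real.posLog
      ‖(Real.exp (n * b * |x| ^ (2 / (n : ℝ))) : ℂ) * transform n k f x / (C : ℂ)‖) ∂(mu n k) < ⊤)
    {σ : ℂ} (hσ : σ = 1 ∨ σ = -1) :
    ∫⁻ s : ℝ, ENNReal.ofReal (Real.posLog ‖halfTransform n k b C f σ s‖) < ⊤ := by
  have hcont : ∀ σ : ℂ, Continuous fun s : ℝ => Real.posLog ‖halfTransform n k b C f σ s‖ := by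
    intro σ
    have d₁ := (differentiable_hankel (neg_half_le_index hn hk) h₁).continuous
    have d₂ := (differentiable_hankel (neg_half_le_index_add hn hk) h₂).continuous
    refine Real.continuous_posLog.comp (Continuous.norm ?_)
    unfold halfTransform
    fun_prop
  have hhalf : ∀ σ : ℂ, σ = 1 ∨ σ = -1 →
      ∫⁻ s in Set.Ioi (0 : ℝ), ENNReal.ofReal (Real.posLog ‖halfTransform n k b C f σ s‖) < ⊤ := by
    rintro σ (rfl | rfl)
    · refine lintegral_Ioi_lt_top_of_mu hn hk (hcont 1)
        (lt_of_le_of_lt ?_ ((setLIntegral_le_lintegral (Set.Ioi 0) _).trans_lt hint))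
      refine (setLIntegral_congr_fun measurableSet_Ioi fun x hx => ?_).le
      have hx' : (0 : ℝ) < x := hx
      rw [exp_mul_transform_eq hn hk b C h₁ h₂ (σ := 1) (by rw [one_mul, abs_of_pos hx']),
        Complex.ofReal_one]
    · refine lintegral_Ioi_lt_top_of_mu hn hk (hcont (-1))
        (lt_of_le_of_lt ?_ ((setLIntegral_le_lintegral (Set.Iio 0) _).trans_lt hint))
      rw [← lintegral_neg_mu n k _ measurableSet_Iio, Set.neg_Iio, neg_zero]
      refine (setLIntegral_congr_fun measurableSet_Ioi fun x hx => ?_).le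
      have hx' : (0 : ℝ) < x := hx
      rw [exp_mul_transform_eq hn hk b C h₁ h₂ (σ := -1)
        (by rw [abs_neg, abs_of_pos hx']; ring), rad_neg, Complex.ofReal_neg, Complex.ofReal_one]
  -- The positive half line comes from one half of (ii); on the negative one the sign `σ (-1)^n`
  -- selects the appropriate half.
  refine lintegral_lt_top_of_halves (hhalf σ hσ) ?_
  simp only [Complex.ofReal_neg, halfTransform_neg hn hk b C h₁ h₂]
  refine hhalf _ ?_
  rcases hσ with rfl | rfl <;> rcases neg_one_pow_eq_or ℂ n with h | h <;> simp [h]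

theorem eq_const_mul_gauss {n : ℕ} (hn : 0 < n) {k : ℝ}
    (hk : ((n : ℝ) - 1) / (2 * n) ≤ k) {a b C : ℝ} (ha : 0 < a) (hb : 0 < b)
    (hab : a * b = 1 / 4) (hC : 0 < C) {p q : ℝ≥0∞} (hp : 1 ≤ p) (hq : 1 ≤ q) {f : ℝ → ℂ}
    (hf : MiyachiCondition n k a b C p q f) :
    ∃ l : ℂ, ‖l‖ ≤ (2 * a) ^ (index n k + 1) * C ∧ ∀ᵐ x ∂(mu n k), f x = l * gauss n a x := by
  obtain ⟨hfm, hfi, hint⟩ := hf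
  have hG := hfi.gaussDom hp hq hfm
  have h₁ := hG.expIntegrable hn hk ha
  have h₂ := hG.expIntegrable_mul_self hn hk ha
  have hconst : ∀ σ : ℂ, σ = 1 ∨ σ = -1 →
      ∃ c : ℂ, ‖c‖ ≤ 1 ∧ ∀ z, halfTransform n k b C f σ z = c := by
    intro σ hσ
    obtain ⟨A, N, hA⟩ := growthBound_halfTransform hn hk ha hb hab hC hG (σ := σ)
      (by rcases hσ with rfl | rfl <;> simp)
    exact hA.eq_const (lintegral_halfTransform_lt_top hn hk h₁ h₂ hint hσ)
  obtain ⟨c, hc1, hc⟩ := hconst 1 (Or.inl rfl)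
  obtain ⟨c', -, hc'⟩ := hconst (-1) (Or.inr rfl)
  -- At `z = 0` the odd term carries `0^n = 0`, so both functions have the same value there.
  have hcc : c' = c := by
    rw [← hc 0, ← hc' 0]
    simp [halfTransform, hn.ne']
  have hC' : (C : ℂ) ≠ 0 := Complex.ofReal_ne_zero.2 hC.ne'
  have hboth : ∀ z : ℂ, hankel n k (index n k) f z = c * C * Complex.exp (-(n * b * z ^ 2)) ∧
      z ^ n * hankel n k (index n k + n) (fun x => x * f x) z = 0 := by
    intro z
    have e₁ := hc z
    have e₂ := hc' z
    rw [hcc] at e₂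
    rw [halfTransform, div_eq_iff hC'] at e₁ e₂
    have hE := Complex.exp_ne_zero (n * b * z ^ 2)
    have hκ := oddConst_ne_zero hn hk
    constructor
    · rw [Complex.exp_neg, ← div_eq_mul_inv, eq_div_iff hE]
      linear_combination (e₁ + e₂) / 2
    · have : Complex.exp (n * b * z ^ 2) * oddConst n k * (2 * (z ^ n *
          hankel n k (index n k + n) (fun x => x * f x) z)) = 0 := by
        linear_combination e₁ - e₂
      exact (mul_eq_zero.1 ((mul_eq_zero.1 this).resolve_left (mul_ne_zero hE hκ))).resolve_left
        two_ne_zero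
  -- The factor `z^n` vanishes only at the origin; continuity fills in that point.
  have ho : ∀ z, hankel n k (index n k + n) (fun x => x * f x) z = 0 := by
    have hcont := (differentiable_hankel (neg_half_le_index_add hn hk) h₂).continuous
    have := Continuous.ext_on (dense_compl_singleton (0 : ℂ)) hcont continuous_const
      (g := fun _ => (0 : ℂ)) fun z hz =>
        (mul_eq_zero.1 (hboth z).2).resolve_left (pow_ne_zero n hz)
    exact fun z => congrFun this z
  have hpow : (0 : ℝ) < (2 * a) ^ (index n k + 1) := by positivity
  refine ⟨c * ((2 * a) ^ (index n k + 1) * C : ℝ), ?_,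
    eq_const_mul_gauss_of_hankel hn hk ha h₁ h₂ (fun z => ?_) ho⟩
  · rw [norm_mul, Complex.norm_real, Real.norm_of_nonneg (by positivity)]
    exact mul_le_of_le_one_left (by positivity) hc1
  · have e : (n : ℂ) * z ^ 2 / (4 * a) = n * b * z ^ 2 := by
      have ha' : (a : ℂ) ≠ 0 := Complex.ofReal_ne_zero.2 ha.ne'
      have hab' : (a : ℂ) * b = 1 / 4 := by
        have := congrArg (fun r : ℝ => (r : ℂ)) hab
        push_cast at this; exact this
      rw [div_eq_iff (by simpa using ha')]
      linear_combination (-4 * n * z ^ 2) * hab'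
    have hinv : (((2 * a) ^ (index n k + 1) : ℝ) : ℂ) * (((2 * a) ^ (-(index n k + 1)) : ℝ) : ℂ)
        = 1 := by
      rw [← Complex.ofReal_mul, Real.rpow_neg (by positivity), mul_inv_cancel₀ hpow.ne',
        Complex.ofReal_one]
    rw [(hboth z).1, hankel_gauss hn hk ha, e, Complex.ofReal_mul]
    linear_combination (-(c * C * Complex.exp (-(n * b * z ^ 2)))) * hinv

/-! ### The cases `ab > 1/4` and `ab < 1/4` -/

theorem MiyachiCondition.mono {n : ℕ} {k a b b' C : ℝ} (hb : b' ≤ b)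
    {p q : ℝ≥0∞} {f : ℝ → ℂ} (hf : MiyachiCondition n k a b C p q f) :
    MiyachiCondition n k a b' C p q f := by
  refine ⟨hf.1, hf.2.1, lt_of_le_of_lt (lintegral_mono fun x => ?_) hf.2.2⟩
  refine ENNReal.ofReal_le_ofReal (Real.posLog_le_posLog (norm_nonneg _) ?_)
  rw [norm_div, norm_div, norm_mul, norm_mul, Complex.norm_real (Real.exp _),
    Complex.norm_real (Real.exp _), Real.norm_of_nonneg (Real.exp_pos _).le,
    Real.norm_of_nonneg (Real.exp_pos _).le]
  gcongr

/-- Condition (ii) weakens as `b` decreases, so the critical case applies with `b' = 1/(4a)`. A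
nonzero Gaussian multiple would make the weighted transform equal to `c e^(δ s²)` in modulus with `δ
> 0`, and `log⁺` of that is not integrable. -/
theorem ae_eq_zero_of_quarter_lt {n : ℕ} (hn : 0 < n) {k : ℝ}
    (hk : ((n : ℝ) - 1) / (2 * n) ≤ k) {a b C : ℝ} (ha : 0 < a) (hab : 1 / 4 < a * b)
    (hC : 0 < C) {p q : ℝ≥0∞} (hp : 1 ≤ p) (hq : 1 ≤ q) {f : ℝ → ℂ}
    (hf : MiyachiCondition n k a b C p q f) : ∀ᵐ x ∂(mu n k), f x = 0 := by
  have hn' : (0 : ℝ) < n := by exact_mod_cast hn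
  set b' := 1 / (4 * a) with hb'
  have hb'pos : 0 < b' := by positivity
  have hlt : b' < b := by
    rw [hb', div_lt_iff₀ (by positivity)]; linarith
  obtain ⟨l, -, hl⟩ := eq_const_mul_gauss hn hk ha hb'pos (by rw [hb']; field_simp) hC hp hq
    (hf.mono hlt.le)
  rcases eq_or_ne l 0 with rfl | hl0
  · filter_upwards [hl] with x hx
    rw [hx, zero_mul]
  exfalso
  have htr : ∀ y, transform n k f y = l * (((2 * a) ^ (-(index n k + 1))
      * Real.exp (-(n * b' * rad n y ^ 2)) : ℝ) : ℂ) := by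
    intro y
    have : transform n k f y = l * transform n k (gauss n a) y := by
      rw [transform, transform, ← integral_const_mul]
      refine integral_congr_ae ?_
      filter_upwards [hl] with x hx
      rw [hx]; ring
    rw [this, transform_gauss hn hk ha, hb']
    congr 4
    ring
  set c : ℝ := ‖l‖ * (2 * a) ^ (-(index n k + 1)) / C with hc
  have hc0 : 0 < c := by
    have := norm_pos_iff.2 hl0
    positivity
  set δ : ℝ := n * (b - b') with hδ
  have hδ0 : 0 < δ := mul_pos hn' (sub_pos.2 hlt)
  have hnorm : ∀ x, ‖(Real.exp (n * b * |x| ^ (2 / (n : ℝ))) : ℂ) * transform n k f x / (C : ℂ)‖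
      = c * Real.exp (δ * rad n x ^ 2) := by
    intro x
    rw [htr, rad_sq, norm_div, norm_mul, norm_mul, Complex.norm_real, Complex.norm_real,
      Complex.norm_real, Real.norm_of_nonneg (Real.exp_pos _).le, Real.norm_of_nonneg hC.le,
      Real.norm_of_nonneg (by positivity), hc, hδ,
      show n * (b - b') * rad n x ^ 2 = n * b * rad n x ^ 2 + -(n * b' * rad n x ^ 2) by ring,
      Real.exp_add]
    ring
  have hint := hf.2.2
  simp_rw [hnorm] at hint
  have hφ : Continuous fun s : ℝ => Real.posLog (c * Real.exp (δ * s ^ 2)) :=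
    Real.continuous_posLog.comp (by fun_prop)
  have hfin := lintegral_Ioi_lt_top_of_mu hn hk hφ
    ((setLIntegral_le_lintegral (Set.Ioi 0) _).trans_lt hint)
  have hlim : Filter.Tendsto (fun s : ℝ => c * Real.exp (δ * s ^ 2)) Filter.atTop Filter.atTop :=
    (Real.tendsto_exp_atTop.comp ((Filter.tendsto_pow_atTop two_ne_zero).const_mul_atTop
      hδ0)).const_mul_atTop hc0
  obtain ⟨R, hR⟩ := Filter.eventually_atTop.1 ((hlim.eventually_ge_atTop (Real.exp 1)).and
    (Filter.eventually_gt_atTop 0))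
  refine hfin.ne (top_le_iff.1 ?_)
  rw [← lintegral_ofReal_const_eq_top (s := Set.Ici R) Real.volume_Ici one_pos ?_ measurableSet_Ici]
  · exact lintegral_mono_set fun x hx => (hR x hx).2
  · intro x hx
    rw [Real.posLog_apply]
    refine le_max_of_le_right ?_
    rw [← Real.log_exp 1]
    exact Real.log_le_log (Real.exp_pos 1) (hR x hx).1

theorem integrable_gauss {n : ℕ} (hn : 0 < n) {k : ℝ} (hk : ((n : ℝ) - 1) / (2 * n) ≤ k)
    {a : ℝ} (ha : 0 < a) : Integrable (gauss n a) (mu n k) := by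
  have h := ((gaussDom_gauss n k a).expIntegrable hn hk ha).integrable_moment hn 0
  simpa using h

theorem memLp_gauss {n : ℕ} (hn : 0 < n) {k : ℝ} (hk : ((n : ℝ) - 1) / (2 * n) ≤ k)
    {a : ℝ} (ha : 0 < a) {p : ℝ≥0∞} (hp : 1 ≤ p) : MemLp (gauss n a) p (mu n k) := by
  have htop : MemLp (gauss n a) ⊤ (mu n k) :=
    memLp_top_of_bound (continuous_gauss n a).aestronglyMeasurable 1
      (Filter.Eventually.of_forall fun x => by
        rw [norm_gauss]
        exact Real.exp_le_one_iff.2 (neg_nonpos.2 (by positivity)))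
  rcases eq_or_ne p ⊤ with rfl | hpt
  · exact htop
  have hp0 : p ≠ 0 := (zero_lt_one.trans_le hp).ne'
  refine (integrable_norm_rpow_iff (continuous_gauss n a).aestronglyMeasurable hp0 hpt).1 ?_
  have e : (fun x => ‖gauss n a x‖ ^ p.toReal) = fun x => ‖gauss n (a * p.toReal) x‖ := by
    ext x
    rw [norm_gauss, norm_gauss, ← Real.exp_mul]
    congr 1
    ring
  rw [e]
  exact (integrable_gauss hn hk (mul_pos ha (ENNReal.toReal_pos hp0 hpt))).norm

theorem miyachiCondition_gauss {n : ℕ} (hn : 0 < n) {k : ℝ}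
    (hk : ((n : ℝ) - 1) / (2 * n) ≤ k) {a a' b C : ℝ} (ha : 0 < a) (haa : a < a')
    (hb : b < 1 / (4 * a')) (hC : 0 < C) {p q : ℝ≥0∞} (hp : 1 ≤ p) :
    MiyachiCondition n k a b C p q (gauss n a') := by
  have ha' : 0 < a' := ha.trans haa
  have hn' : (0 : ℝ) < n := by exact_mod_cast hn
  refine ⟨(continuous_gauss n a').aestronglyMeasurable, ?_, ?_⟩
  -- The surplus decay `a' - a` puts the weighted function in `L^p` alone, so the `L^q` summand is
  -- zero.
  · refine ⟨gauss n (a' - a), 0, memLp_gauss hn hk (sub_pos.2 haa) hp, MemLp.zero,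
      Filter.Eventually.of_forall fun x => ?_⟩
    simp only [Pi.zero_apply, add_zero, gauss, rad_sq]
    rw [← Complex.ofReal_mul, ← Real.exp_add]
    congr 2
    ring
  · set δ : ℝ := 1 / (4 * a') - b with hδ
    have hδ0 : 0 < δ := sub_pos.2 hb
    set c : ℝ := (2 * a') ^ (-(index n k + 1)) / C with hc
    have hc0 : 0 < c := by positivity
    have hi := ((integrable_gauss hn hk hδ0).norm.const_mul c).2
    refine lt_of_le_of_lt (lintegral_mono fun x => ?_) hi
    rw [← ofReal_norm]
    refine ENNReal.ofReal_le_ofReal ?_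
    simp only [norm_mul, norm_norm]
    rw [norm_gauss, transform_gauss hn hk ha', rad_sq, norm_div, norm_mul, Complex.norm_real,
      Complex.norm_real, Complex.norm_real, Real.norm_of_nonneg (Real.exp_pos _).le,
      Real.norm_of_nonneg hC.le, Real.norm_of_nonneg (by positivity),
      Real.norm_of_nonneg (by positivity)]
    have e : Real.exp (n * b * rad n x ^ 2) * ((2 * a') ^ (-(index n k + 1)) *
        Real.exp (-(n * rad n x ^ 2 / (4 * a')))) / C
        = c * Real.exp (-(n * δ * rad n x ^ 2)) := by
      rw [hc, hδ, show -(n * (1 / (4 * a') - b) * rad n x ^ 2)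
        = n * b * rad n x ^ 2 + -(n * rad n x ^ 2 / (4 * a')) by ring, Real.exp_add]
      ring
    rw [e, Real.posLog_apply]
    -- The bound `log r ≤ r - 1` places `log⁺` below a multiple of an integrable Gaussian.
    exact max_le (by positivity) ((Real.log_le_sub_one_of_pos (by positivity)).trans (by linarith))

/-- At `x = (√i)^n` the Gaussians take the values `u_j^i` with distinct `u_j`. The relation thus
holds against every polynomial in `u_j`, and Lagrange basis polynomials isolate the coefficients. -/
theorem gauss_linearIndependent {n : ℕ} (hn : 0 < n) {A : ℕ → ℝ} (hA : Function.Injective A)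
    (s : Finset ℕ) (c : ℕ → ℂ) (h : ∀ᵐ x : ℝ, ∑ j ∈ s, c j * gauss n (A j) x = 0) :
    ∀ j ∈ s, c j = 0 := by
  have hn' : (0 : ℝ) < n := by exact_mod_cast hn
  have hcont : Continuous fun x => ∑ j ∈ s, c j * gauss n (A j) x :=
    continuous_finsetSum _ fun j _ => continuous_const.mul (continuous_gauss n (A j))
  have hall : ∀ x, ∑ j ∈ s, c j * gauss n (A j) x = 0 := by
    intro x
    exact congrFun (Continuous.ae_eq_iff_eq volume hcont continuous_const |>.1 h) x
  set u : ℕ → ℂ := fun j => (Real.exp (-(n * A j)) : ℝ) with hu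
  have huinj : Set.InjOn u s := by
    intro i _ j _ hij
    have h1 := Real.exp_injective (Complex.ofReal_injective hij)
    exact hA (mul_left_cancel₀ hn'.ne' (neg_injective h1))
  have hpow : ∀ i : ℕ, ∑ j ∈ s, c j * u j ^ i = 0 := by
    intro i
    rw [← hall (Real.sqrt i ^ n)]
    refine Finset.sum_congr rfl fun j _ => ?_
    rw [gauss, rad_of_pow hn (Real.sqrt_nonneg _), Real.sq_sqrt i.cast_nonneg, hu]
    simp only
    rw [← Complex.ofReal_pow, ← Real.exp_nat_mul]
    congr 3
    ring
  have hpoly : ∀ P : Polynomial ℂ, ∑ j ∈ s, c j * P.eval (u j) = 0 := by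
    intro P
    simp_rw [Polynomial.eval_eq_sum_range, Finset.mul_sum]
    rw [Finset.sum_comm]
    refine Finset.sum_eq_zero fun i _ => ?_
    have := congrArg (fun w => P.coeff i * w) (hpow i)
    simp only [Finset.mul_sum, mul_zero] at this
    rw [← this]
    exact Finset.sum_congr rfl fun j _ => by ring
  intro j hj
  have h1 := hpoly (Lagrange.basis s u j)
  rw [Finset.sum_eq_single_of_mem j hj (fun i hi hij => by
    rw [Lagrange.eval_basis_of_ne hij.symm hi, mul_zero]), Lagrange.eval_basis_self huinj hj,
    mul_one] at h1
  exact h1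

end GenFourier

/-! ### The main theorem -/

theorem theorem5p3 (n : ℕ) (hn : 0 < n) (k : ℝ) (hk : ((n : ℝ) - 1) / (2 * n) ≤ k)
    (a b C : ℝ) (ha : 0 < a) (hb : 0 < b) (hC : 0 < C)
    (p q : ℝ≥0∞) (hp : 1 ≤ p) (hq : 1 ≤ q) :
    (1 / 4 < a * b → ∀ f : ℝ → ℂ, GenFourier.MiyachiCondition n k a b C p q f →
      ∀ᵐ x : ℝ, f x = 0) ∧
    (a * b = 1 / 4 → ∀ f : ℝ → ℂ, GenFourier.MiyachiCondition n k a b C p q f →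
      ∃ l : ℂ, ‖l‖ ≤ (2 * a) ^ (k * n - n / 2 + 1) * C ∧
        ∀ᵐ x : ℝ, f x = l * (Real.exp (-(n * a * |x| ^ (2 / (n : ℝ)))) : ℂ)) ∧
    (a * b < 1 / 4 → ∃ F : ℕ → ℝ → ℂ,
      (∀ j, GenFourier.MiyachiCondition n k a b C p q (F j)) ∧
      ∀ (s : Finset ℕ) (c : ℕ → ℂ), (∀ᵐ x : ℝ, ∑ j ∈ s, c j * F j x = 0) →
        ∀ j ∈ s, c j = 0) := by
  have hac := GenFourier.volume_absolutelyContinuous hn hk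
  refine ⟨fun hab f hf => hac.ae_le
    (GenFourier.ae_eq_zero_of_quarter_lt hn hk ha hab hC hp hq hf), fun hab f hf => ?_,
    fun hab => ?_⟩
  · obtain ⟨l, hl, hfl⟩ := GenFourier.eq_const_mul_gauss hn hk ha hb hab hC hp hq hf
    refine ⟨l, hl, ?_⟩
    filter_upwards [hac.ae_le hfl] with x hx
    rw [hx, GenFourier.gauss, GenFourier.rad_sq]
  -- `d` is the length of the interval of admissible parameters `(a, 1/(4b))`. The denominator `j +
  -- 2`, rather than `j + 1`, keeps the term `j = 0` strictly below the upper end.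
  · set d : ℝ := 1 / (4 * b) - a with hd
    have hd0 : 0 < d := by
      rw [hd, sub_pos, lt_div_iff₀ (by positivity)]; linarith
    set A : ℕ → ℝ := fun j => a + d / (j + 2) with hA
    have hlow : ∀ j, a < A j := fun j => by
      have : 0 < d / ((j : ℝ) + 2) := by positivity
      simp only [hA]; linarith
    have hup : ∀ j, b < 1 / (4 * A j) := fun j => by
      have hj : (0 : ℝ) ≤ j := j.cast_nonneg
      have h1 : d / ((j : ℝ) + 2) < d := div_lt_self hd0 (by linarith)
      have h2 : A j < 1 / (4 * b) := by simp only [hA]; linarith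
      have h3 : 0 < A j := ha.trans (hlow j)
      rw [lt_div_iff₀ (by positivity)] at h2 ⊢
      linarith
    have hinj : Function.Injective A := by
      intro i j hij
      have h1 : d / ((i : ℝ) + 2) = d / ((j : ℝ) + 2) := add_left_cancel hij
      rw [div_eq_div_iff (by positivity) (by positivity)] at h1
      have h2 := mul_left_cancel₀ hd0.ne' h1
      exact_mod_cast (by linarith : (i : ℝ) = j)
    exact ⟨fun j => GenFourier.gauss n (A j),
      fun j => GenFourier.miyachiCondition_gauss hn hk ha (hlow j) (hup j) hC hp,
      fun s c h => GenFourier.gauss_linearIndependent hn hinj s c h⟩
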